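/- Let $A=(a_{ij})_{1\le i,j\le n}$ be a symmetrizable generalized Cartan matrix and let $d_1,\dots,d_n$ be positive integers such that $(d_ia_{ij})$ is symmetric. Let $\mathfrak g$ be the Kac–Moody Lie algebra of $A$ over $\mathbb C$: if $r$ is the rank of $A$ and $S\subset\{1,\dots,n\}$ has $n-r$ elements and is such that the principal submatrix of $A$ on the complement of $S$ is nondegenerate, then $\mathfrak g$ has generators $\bar e_i,\bar f_i,\bar h_i$ ($1\le i\le n$) and $\bar D_j$ ($j\in S$) and relations: the $\bar h_i,\bar D_j$ commute with each other, $[\bar h_i,\bar e_j]=a_{ij}\bar e_j$, $[\bar h_i,\bar f_j]=-a_{ij}\bar f_j$, $[\bar D_j,\bar e_i]=\delta_{ij}\bar e_i$, $[\bar D_j,\bar f_i]=-\delta_{ij}\bar f_i$, $[\bar e_i,\bar f_j]=\delta_{ij}\bar h_i$, and $\mathrm{ad}(\bar e_i)^{1-a_{ij}}(\bar e_j)=\mathrm{ad}(\bar f_i)^{1-a_{ij}}(\bar f_j)=0$ for $i\ne j$. Let $\mathfrak n_+$ be the Lie subalgebra of $\mathfrak g$ generated by the $\bar e_i$, and let $L\mathfrak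 n_+=\mathfrak n_+\otimes\mathbb C[t,t^{-1}]$ with bracket $[x\otimes t^k,y\otimes t^l]=[x,y]\otimes t^{k+l}$. Let $\Delta_+\subset\mathbb N^n$ be the set of positive roots of $\mathfrak g$, where the simple roots $\epsilon_1,\dots,\epsilon_n$ are identified with the standard basis of $\mathbb Z^n$. A root is real if it is the image of a simple root under the Weyl group, and imaginary otherwise. Let $q=e^\hbar\in\mathbb C[[\hbar]]$. Let $\mathcal A$ be the quotient of the free algebra $\mathbb C[[\hbar]]\langle e_i[k],\,1\le i\le n,\,k\in\mathbb Z\rangle$ by the two-sided ideal generated by the coefficients of monomials in $$(q^{d_ia_{ij}}z-w)e_i(z)e_j(w)=(z-q^{d_ia_{ij}}w)e_j(w)e_i(z)\qquad(\text{all } i,j),$$ $$\mathrm{Sym}_{z_1,\dots,z_{1-a_{ij}}}\sum_{p=0}^{1-a_{ij}}(-1)^p\begin{bmatrix}1-a_{ij}\\p\end{bmatrix}_{q^{d_i}}e_i(z_1)\cdots e_i(z_p)e_j(w)e_i(z_{p+1})\cdots e_i(z_{1-a_{ij}})=0\qquad(i\ne j),$$ where $e_i(z)=\sum_{k\in\mathbb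 Z}e_i[k]z^{-k}$. The $q$-binomials are $\begin{bmatrix}m\\p\end{bmatrix}_q=\frac{[m]_q!}{[p]_q![m-p]_q!}$, with $[k]_q=\frac{q^k-q^{-k}}{q-q^{-1}}$ and $[k]_q!=[1]_q\cdots[k]_q$. Let $\tilde{\mathcal A}$ be defined in the same way, with the second family of relations replaced by $$\sum_{p=0}^{1-a_{ij}}(-1)^p\begin{bmatrix}1-a_{ij}\\p\end{bmatrix}_{q^{d_i}}e_i[0]^p\,e_j[l]\,e_i[0]^{1-a_{ij}-p}=0\qquad(i\neq j,\ l\in\mathbb Z).$$ Put $U_\hbar L\mathfrak n_+=\mathcal A/\bigcap_{N>0}\hbar^N\mathcal A$ and $\tilde U_\hbar L\mathfrak n_+=\tilde{\mathcal A}/\bigcap_{N>0}\hbar^N\tilde{\mathcal A}$. 1) Let $\tilde F_+$ be the Lie algebra over $\mathbb C$ with generators $\tilde x_i[k]$, $1\le i\le n$, $k\in\mathbb Z$, and relations given by the coefficients of monomials in $$(z-w)[\tilde x_i(z),\tilde x_j(w)]=0\quad(\text{all }i,j),\qquad \mathrm{ad}(\tilde x_i(z_1))\cdots\mathrm{ad}(\tilde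 x_i(z_{1-a_{ij}}))(\tilde x_j(w))=0\quad(i\ne j),$$ where $\tilde x_i(z)=\sum_{k\in\mathbb Z}\tilde x_i[k]z^{-k}$. For $\alpha\in\mathbb Z^n$ let $\tilde F_+[\alpha]$ be the span of the iterated brackets of generators of total degree $\alpha$, where $\tilde x_i[k]$ has degree $\epsilon_i$. Then $\tilde F_+$ is graded by $\Delta_+$: $[\tilde F_+[\alpha],\tilde F_+[\beta]]\subset\tilde F_+[\alpha+\beta]$, $\tilde F_+[\alpha]=0$ for $\alpha\notin\Delta_+$, and $\tilde F_+=\bigoplus_{\alpha\in\Delta_+}\tilde F_+[\alpha]$. Moreover, there are isomorphisms of $\mathbb C$-algebras from $U_\hbar L\mathfrak n_+/\hbar U_\hbar L\mathfrak n_+$ and from $\tilde U_\hbar L\mathfrak n_+/\hbar\tilde U_\hbar L\mathfrak n_+$ to the enveloping algebra $U(\tilde F_+)$, sending the class of each $e_i[k]$ to $\tilde x_i[k]$. 2) There is a unique Lie algebra morphism $j_+:\tilde F_+\to L\mathfrak n_+$ such that $j_+(\tilde x_i[k])=\bar e_i\otimes t^k$ for all $i$ and $k$. It is graded, i.e. $j_+(\tilde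 F_+[\alpha])\subset\mathfrak n_+[\alpha]\otimes\mathbb C[t,t^{-1}]$ for all $\alpha$, where $\mathfrak n_+[\alpha]$ is the intersection of $\mathfrak n_+$ with the weight space of weight $\alpha$ in $\mathfrak g$. It is also surjective, and its kernel is contained in $\bigoplus_{\alpha\in\Delta_+,\ \alpha\text{ imaginary}}\tilde F_+[\alpha]$. -/

import Mathlib

open scoped PowerSeries TensorProduct

noncomputable section

/-! ### Symmetrizable Cartan matrices -/

/-- Generalized Cartan matrices. -/
structure IsGenCartan {n : ℕ} (A : Matrix (Fin n) (Fin n) ℤ) : Prop where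
  diag : ∀ i, A i i = 2
  offdiag : ∀ i j, i ≠ j → A i j ≤ 0
  zero_symm : ∀ i j, A i j = 0 → A j i = 0

/-- The `d i` are positive integers such that the matrix `(d i * A i j)` is symmetric. -/
structure IsSymmetrizer {n : ℕ} (A : Matrix (Fin n) (Fin n) ℤ) (d : Fin n → ℕ) : Prop where
  pos : ∀ i, 0 < d i
  symm : ∀ i j, (d i : ℤ) * A i j = (d j : ℤ) * A j i

/-- With `r` the rank of `A`, the complement of `S` has `r` elements, and the principal submatrix
of `A` on that complement is nondegenerate. After renumbering, `S = {1, …, n - r}`. -/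
structure IsCorankSet {n : ℕ} (A : Matrix (Fin n) (Fin n) ℤ) (S : Finset (Fin n)) : Prop where
  card_add_rank : S.card + (A.map (Int.cast : ℤ → ℚ)).rank = n
  nondeg : (A.submatrix (Subtype.val : {i // i ∉ S} → Fin n) Subtype.val).det ≠ 0

/-- The length `1 - a_ij` of the Serre relations; only used for `i ≠ j`, where `a_ij ≤ 0`. -/
def serreLen {n : ℕ} (A : Matrix (Fin n) (Fin n) ℤ) (i j : Fin n) : ℕ := (1 - A i j).toNat

/-! ### The Kac-Moody Lie algebra, its positive part and its roots -/

/-- Generators of the Kac-Moody algebra: `h_i`, `D_j` (`j ∈ S`), `x_i^+ = e_i`, `x_i^- = f_i`. -/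
inductive KMGen {n : ℕ} (S : Finset (Fin n)) : Type
  | h (i : Fin n)
  | D (j : {j // j ∈ S})
  | e (i : Fin n)
  | f (i : Fin n)

namespace KMGen

variable {n : ℕ} (S : Finset (Fin n))

/-- The generator `h_i` of the free Lie algebra. -/
def freeH (i : Fin n) : FreeLieAlgebra ℂ (KMGen S) := FreeLieAlgebra.of ℂ (KMGen.h i)
/-- The generator `D_j` of the free Lie algebra. -/
def freeD (j : {j // j ∈ S}) : FreeLieAlgebra ℂ (KMGen S) := FreeLieAlgebra.of ℂ (KMGen.D j)
/-- The generator `e_i` of the free Lie algebra. -/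
def freeE (i : Fin n) : FreeLieAlgebra ℂ (KMGen S) := FreeLieAlgebra.of ℂ (KMGen.e i)
/-- The generator `f_i` of the free Lie algebra. -/
def freeF (i : Fin n) : FreeLieAlgebra ℂ (KMGen S) := FreeLieAlgebra.of ℂ (KMGen.f i)

end KMGen

open KMGen in
/-- The defining relations of the Kac-Moody algebra: `KMRel A S x` says that `x` is one of the
elements that are set equal to zero. -/
inductive KMRel {n : ℕ} (A : Matrix (Fin n) (Fin n) ℤ) (S : Finset (Fin n)) :
    FreeLieAlgebra ℂ (KMGen S) → Prop
  | hh (i j) : KMRel A S ⁅freeH S i, freeH S j⁆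
  | hD (i j) : KMRel A S ⁅freeH S i, freeD S j⁆
  | DD (i j) : KMRel A S ⁅freeD S i, freeD S j⁆
  | he (i j) : KMRel A S (⁅freeH S i, freeE S j⁆ - (A i j : ℂ) • freeE S j)
  | hf (i j) : KMRel A S (⁅freeH S i, freeF S j⁆ + (A i j : ℂ) • freeF S j)
  | De (j i) : KMRel A S (⁅freeD S j, freeE S i⁆ - (if i = j.1 then (1 : ℂ) else 0) • freeE S i)
  | Df (j i) : KMRel A S (⁅freeD S j, freeF S i⁆ + (if i = j.1 then (1 : ℂ) else 0) • freeF S i)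
  | ef (i j) : KMRel A S (⁅freeE S i, freeF S j⁆ - (if i = j then (1 : ℂ) else 0) • freeH S i)
  | serreE (i j) (hij : i ≠ j) :
      KMRel A S (((LieAlgebra.ad ℂ _ (freeE S i)) ^ serreLen A i j) (freeE S j))
  | serreF (i j) (hij : i ≠ j) :
      KMRel A S (((LieAlgebra.ad ℂ _ (freeF S i)) ^ serreLen A i j) (freeF S j))

/-- The Kac-Moody Lie algebra `𝔤` over `ℂ` associated with `A`. -/
abbrev KacMoody {n : ℕ} (A : Matrix (Fin n) (Fin n) ℤ) (S : Finset (Fin n)) : Type :=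
  FreeLieAlgebra ℂ (KMGen S) ⧸
    (LieSubmodule.lieSpan ℂ (FreeLieAlgebra ℂ (KMGen S)) {x | KMRel A S x} :
      LieIdeal ℂ (FreeLieAlgebra ℂ (KMGen S)))

namespace KacMoody

variable {n : ℕ} (A : Matrix (Fin n) (Fin n) ℤ) (S : Finset (Fin n))

/-- The image in `𝔤` of a generator. -/
def gen (g : KMGen S) : KacMoody A S := LieSubmodule.Quotient.mk (FreeLieAlgebra.of ℂ g)

/-- The positive part `𝔫₊`: the Lie subalgebra of `𝔤` generated by the `e_i`. -/
def nPlus : LieSubalgebra ℂ (KacMoody A S) :=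
  LieSubalgebra.lieSpan ℂ (KacMoody A S) (Set.range fun i => gen A S (.e i))

/-- The generator `e_i` of `𝔫₊`. -/
def nGen (i : Fin n) : nPlus A S :=
  ⟨gen A S (.e i), LieSubalgebra.subset_lieSpan (Set.mem_range_self i)⟩

/-- For `α = ∑ α_j ε_j`, with `ε_1, …, ε_n` the simple roots (`ε_j(h_i) = a_ij`, `ε_j(D_k) = δ_jk`),
the subspace `𝔤[α] = {x | [h, x] = α(h) x for all h in the Cartan subalgebra}`. -/
def rootSpace (α : Fin n → ℤ) : Submodule ℂ (KacMoody A S) where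
  carrier := {x | (∀ i, ⁅gen A S (.h i), x⁆ = ((∑ j, A i j * α j : ℤ) : ℂ) • x) ∧
    ∀ j : {j // j ∈ S}, ⁅gen A S (.D j), x⁆ = ((α j.1 : ℤ) : ℂ) • x}
  add_mem' := by
    rintro x y ⟨hx, hx'⟩ ⟨hy, hy'⟩
    exact ⟨fun i => by rw [lie_add, hx, hy, smul_add],
      fun j => by rw [lie_add, hx', hy', smul_add]⟩
  zero_mem' := ⟨fun i => by simp, fun j => by simp⟩
  smul_mem' := by
    rintro c x ⟨hx, hx'⟩
    exact ⟨fun i => by rw [lie_smul, hx, smul_comm], fun j => by rw [lie_smul, hx', smul_comm]⟩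

/-- The component `𝔫₊[α] = 𝔫₊ ∩ 𝔤[α]`. -/
def nPart (α : Fin n → ℤ) : Submodule ℂ (nPlus A S) :=
  (rootSpace A S α).comap (nPlus A S).toSubmodule.subtype

/-- The set `Δ₊` of positive roots of `𝔤`, in coordinates with respect to the simple roots. -/
def posRoots : Set (Fin n → ℤ) :=
  {α | α ≠ 0 ∧ (∀ i, 0 ≤ α i) ∧ rootSpace A S α ≠ ⊥}

/-- The simple reflection `s_i(α) = α - α(h_i) ε_i` of the root lattice. -/
def reflection (i : Fin n) : Module.End ℤ (Fin n → ℤ) :=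
  LinearMap.id - LinearMap.smulRight
    (∑ j, A i j • (LinearMap.proj j : (Fin n → ℤ) →ₗ[ℤ] ℤ)) (Pi.single i (1 : ℤ))

theorem reflection_apply (i : Fin n) (α : Fin n → ℤ) :
    reflection A i α = α - (∑ j, A i j * α j) • Pi.single i (1 : ℤ) := by
  simp [reflection]

/-- The Weyl group, acting on the root lattice. (The simple reflections are involutions, so the
monoid that they generate is a group.) -/
def weylGroup : Submonoid (Module.End ℤ (Fin n → ℤ)) :=
  Submonoid.closure (Set.range (reflection A))

/-- Real roots are the images of the simple roots under the Weyl group. -/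
def IsReal (α : Fin n → ℤ) : Prop :=
  ∃ w ∈ weylGroup A, ∃ i, α = w (Pi.single i 1)

/-- The imaginary positive roots. -/
def imPosRoots : Set (Fin n → ℤ) := {α | α ∈ posRoots A S ∧ ¬ IsReal A α}

/-- The loop algebra `L𝔫₊ = 𝔫₊ ⊗ ℂ[t, t⁻¹]`. -/
abbrev LnPlus : Type := LieAlgebra.loopAlgebra ℂ ℤ (nPlus A S)

/-- The element `x ⊗ t^k` of `L𝔫₊`. -/
def loopMonomial (x : nPlus A S) (k : ℤ) : LnPlus A S :=
  (AddMonoidAlgebra.single k (1 : ℂ) : AddMonoidAlgebra ℂ ℤ) ⊗ₜ[ℂ] x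

/-- The component `𝔫₊[α] ⊗ ℂ[t, t⁻¹]` of `L𝔫₊`. -/
def LnPart (α : Fin n → ℤ) : Submodule ℂ (LnPlus A S) :=
  Submodule.span ℂ {y | ∃ x ∈ nPart A S α, ∃ k : ℤ, y = loopMonomial A S x k}

end KacMoody

/-! ### The Lie algebra `F̃₊` -/

/-- The generator `x_i[k]` of the free Lie algebra. -/
def freeX {n : ℕ} (i : Fin n) (k : ℤ) : FreeLieAlgebra ℂ (Fin n × ℤ) := FreeLieAlgebra.of ℂ (i, k)

/-- The defining relations of `F̃₊`. With `x_i(z) = ∑ x_i[k] z^(-k)`, these are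

* `current`: the coefficient of `z^(-k) w^(-l)` in `(z - w)[x_i(z), x_j(w)]`;
* `serre`: the coefficient of `z_1^(-k_1) ⋯ z_m^(-k_m) w^(-l)` in
  `ad x_i(z_1) ⋯ ad x_i(z_m) (x_j(w))`, where `m = 1 - a_ij` and `i ≠ j`. -/
inductive LoopRel {n : ℕ} (A : Matrix (Fin n) (Fin n) ℤ) :
    FreeLieAlgebra ℂ (Fin n × ℤ) → Prop
  | current (i j : Fin n) (k l : ℤ) :
      LoopRel A (⁅freeX i (k + 1), freeX j l⁆ - ⁅freeX i k, freeX j (l + 1)⁆)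
  | serre (i j : Fin n) (hij : i ≠ j) (k : Fin (serreLen A i j) → ℤ) (l : ℤ) :
      LoopRel A ((List.ofFn k).foldr (fun s y => ⁅freeX i s, y⁆) (freeX j l))

/-- The Lie algebra `F̃₊` over `ℂ`. -/
abbrev FPlus {n : ℕ} (A : Matrix (Fin n) (Fin n) ℤ) : Type :=
  FreeLieAlgebra ℂ (Fin n × ℤ) ⧸
    (LieSubmodule.lieSpan ℂ (FreeLieAlgebra ℂ (Fin n × ℤ)) {x | LoopRel A x} :
      LieIdeal ℂ (FreeLieAlgebra ℂ (Fin n × ℤ)))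

namespace FPlus

variable {n : ℕ} (A : Matrix (Fin n) (Fin n) ℤ)

/-- The generator `x_i[k]` of `F̃₊`. -/
def gen (i : Fin n) (k : ℤ) : FPlus A := LieSubmodule.Quotient.mk (freeX i k)

/-- `IsMonomial A α x`: `x` is an iterated bracket of generators, of total degree `α`,
where `x_i[k]` has degree `ε_i`. -/
inductive IsMonomial : (Fin n → ℤ) → FPlus A → Prop
  | gen (i : Fin n) (k : ℤ) : IsMonomial (Pi.single i 1) (gen A i k)
  | lie {α β : Fin n → ℤ} {x y : FPlus A} :
      IsMonomial α x → IsMonomial β y → IsMonomial (α + β) ⁅x, y⁆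

/-- The component `F̃₊[α]` of degree `α`, where `x_i[k]` has degree `ε_i`. -/
def part (α : Fin n → ℤ) : Submodule ℂ (FPlus A) := Submodule.span ℂ {x | IsMonomial A α x}

end FPlus

/-! ### Quantum current algebras over `ℂ[[ħ]]` -/

/-- The formal parameter `ħ`. -/
def hbar : ℂ⟦X⟧ := PowerSeries.X

/-- `q^m`, where `q = e^ħ`. -/
def qPow (m : ℤ) : ℂ⟦X⟧ := PowerSeries.rescale (m : ℂ) (PowerSeries.exp ℂ)

/-- The `q`-integer `[k]_{q^d} = q^{d(k-1)} + q^{d(k-3)} + ⋯ + q^{-d(k-1)}`. -/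
def qInt (d k : ℕ) : ℂ⟦X⟧ :=
  ∑ s ∈ Finset.range k, qPow ((d : ℤ) * ((k : ℤ) - 1 - 2 * (s : ℤ)))

/-- The `q`-factorial `[m]_{q^d}!`. -/
def qFact (d m : ℕ) : ℂ⟦X⟧ := ∏ k ∈ Finset.range m, qInt d (k + 1)

/-- The Gaussian binomial `[m]! / ([p]! [m - p]!)`, with base `q^d`, for `p ≤ m`. The divisors have
nonzero constant coefficient, and `⁻¹` is the inverse in `ℂ[[ħ]]`. -/
def qBinom (d m p : ℕ) : ℂ⟦X⟧ := qFact d m * (qFact d p)⁻¹ * (qFact d (m - p))⁻¹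

theorem qPow_mul (a b : ℤ) : qPow a * qPow b = qPow (a + b) := by
  unfold qPow
  rw [PowerSeries.exp_mul_exp_eq_exp_add]
  push_cast
  rfl

/-- `[k]_{q^d}` is the quotient of `q^{dk} - q^{-dk}` by `q^d - q^{-d}`. -/
theorem qInt_mul (d k : ℕ) :
    qInt d k * (qPow d - qPow (-d)) = qPow ((d : ℤ) * k) - qPow (-((d : ℤ) * k)) := by
  have key : ∀ N : ℕ, (∑ s ∈ Finset.range N, qPow ((d : ℤ) * ((k : ℤ) - 1 - 2 * (s : ℤ)))) *
      (qPow d - qPow (-d)) = qPow ((d : ℤ) * k) - qPow ((d : ℤ) * (k - 2 * N)) := by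
    intro N
    induction N with
    | zero => simp
    | succ N ih =>
      rw [Finset.sum_range_succ, add_mul, ih, mul_sub (qPow _), qPow_mul, qPow_mul]
      push_cast
      ring_nf
  rw [qInt, key]
  congr 2
  ring

theorem constantCoeff_qFact (d m : ℕ) : PowerSeries.constantCoeff (qFact d m) = (m.factorial : ℂ) := by
  have h : ∀ k, PowerSeries.constantCoeff (qInt d k) = (k : ℂ) := by
    intro k
    have h1 : ∀ a : ℂ, PowerSeries.constantCoeff (PowerSeries.rescale a (PowerSeries.exp ℂ)) = 1 := by
      intro a
      rw [← PowerSeries.coeff_zero_eq_constantCoeff_apply, PowerSeries.coeff_rescale]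
      simp
    simp only [qInt, qPow, map_sum, h1]
    simp
  simp only [qFact, map_prod, h]
  rw [← Finset.prod_range_add_one_eq_factorial]
  push_cast
  rfl

namespace QuantumCurrent

variable {n : ℕ}

/-- The free algebra `ℂ[[ħ]]⟨e_i[k], i = 1, …, n, k ∈ ℤ⟩`. -/
abbrev Free (n : ℕ) : Type := FreeAlgebra ℂ⟦X⟧ (Fin n × ℤ)

/-- The generator `e_i[k]` of the free algebra. -/
def freeGen (i : Fin n) (k : ℤ) : Free n := FreeAlgebra.ι ℂ⟦X⟧ (i, k)

/-- The coefficient of `z^(-k) w^(-l)` in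
`(q^b z - w) e_i(z) e_j(w) - (z - q^b w) e_j(w) e_i(z)`, where `b = d_i a_ij`
and `e_i(z) = ∑ e_i[k] z^(-k)`. -/
def vertexElt (A : Matrix (Fin n) (Fin n) ℤ) (d : Fin n → ℕ) (i j : Fin n) (k l : ℤ) : Free n :=
  (qPow (d i * A i j) • (freeGen i (k + 1) * freeGen j l) - freeGen i k * freeGen j (l + 1)) -
    (freeGen j l * freeGen i (k + 1) - qPow (d i * A i j) • (freeGen j (l + 1) * freeGen i k))

/-- The coefficient of `z_1^(-k_1) ⋯ z_m^(-k_m) w^(-l)`, where `m = 1 - a_ij`, in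
`Sym_{z_1, …, z_m} ∑_p (-1)^p [m choose p]_{q^{d_i}}
  e_i(z_1) ⋯ e_i(z_p) e_j(w) e_i(z_{p+1}) ⋯ e_i(z_m)`. -/
def serreElt (A : Matrix (Fin n) (Fin n) ℤ) (d : Fin n → ℕ) (i j : Fin n)
    (k : Fin (serreLen A i j) → ℤ) (l : ℤ) : Free n :=
  ∑ σ : Equiv.Perm (Fin (serreLen A i j)), ∑ p ∈ Finset.range (serreLen A i j + 1),
    ((-1) ^ p * qBinom (d i) (serreLen A i j) p) •
      (((List.ofFn fun s => freeGen i (k (σ s))).take p).prod * freeGen j l *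
        ((List.ofFn fun s => freeGen i (k (σ s))).drop p).prod)

/-- The element
`∑_p (-1)^p [m choose p]_{q^{d_i}} e_i[0]^p e_j[l] e_i[0]^{m-p}`, where `m = 1 - a_ij`. -/
def serreElt₀ (A : Matrix (Fin n) (Fin n) ℤ) (d : Fin n → ℕ) (i j : Fin n) (l : ℤ) : Free n :=
  ∑ p ∈ Finset.range (serreLen A i j + 1),
    ((-1) ^ p * qBinom (d i) (serreLen A i j) p) •
      (freeGen i 0 ^ p * freeGen j l * freeGen i 0 ^ (serreLen A i j - p))

/-- The defining relations of `𝒜`. -/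
inductive ARel (A : Matrix (Fin n) (Fin n) ℤ) (d : Fin n → ℕ) : Free n → Free n → Prop
  | vertex (i j : Fin n) (k l : ℤ) : ARel A d (vertexElt A d i j k l) 0
  | serre (i j : Fin n) (hij : i ≠ j) (k : Fin (serreLen A i j) → ℤ) (l : ℤ) :
      ARel A d (serreElt A d i j k l) 0

/-- The defining relations of `𝒜̃`. -/
inductive AtRel (A : Matrix (Fin n) (Fin n) ℤ) (d : Fin n → ℕ) : Free n → Free n → Prop
  | vertex (i j : Fin n) (k l : ℤ) : AtRel A d (vertexElt A d i j k l) 0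
  | serre (i j : Fin n) (hij : i ≠ j) (l : ℤ) : AtRel A d (serreElt₀ A d i j l) 0

section Hbar

variable (B : Type) [Ring B] [Algebra ℂ⟦X⟧ B]

/-- Kills the elements of `⋂_{N > 0} ħ^N B`. -/
inductive SepRel : B → B → Prop
  | mk (x : B) (hx : ∀ N : ℕ, 0 < N → ∃ y : B, x = hbar ^ N • y) : SepRel x 0

/-- The quotient `B / ⋂_{N > 0} ħ^N B`. -/
abbrev Sep : Type := RingQuot (SepRel B)

/-- Kills the elements of `ħ B`. -/
inductive HbarRel : B → B → Prop
  | mk (y : B) : HbarRel (hbar • y) 0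

/-- The quotient `B / ħ B`. -/
abbrev ModHbar : Type := RingQuot (HbarRel B)

end Hbar

variable (A : Matrix (Fin n) (Fin n) ℤ) (d : Fin n → ℕ)

/-- The algebra `𝒜`. -/
abbrev AlgA : Type := RingQuot (ARel A d)

/-- The algebra `𝒜̃`. -/
abbrev AlgAt : Type := RingQuot (AtRel A d)

/-- `U_ħ L𝔫₊ = 𝒜 / ⋂_{N > 0} ħ^N 𝒜`. -/
abbrev U : Type := Sep (AlgA A d)

/-- `Ũ_ħ L𝔫₊ = 𝒜̃ / ⋂_{N > 0} ħ^N 𝒜̃`. -/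
abbrev Ut : Type := Sep (AlgAt A d)

/-- The class of `e_i[k]` in `U_ħ L𝔫₊`. -/
def uGen (i : Fin n) (k : ℤ) : U A d :=
  RingQuot.mkAlgHom ℂ⟦X⟧ _ (RingQuot.mkAlgHom ℂ⟦X⟧ (ARel A d) (freeGen i k))

/-- The class of `e_i[k]` in `Ũ_ħ L𝔫₊`. -/
def utGen (i : Fin n) (k : ℤ) : Ut A d :=
  RingQuot.mkAlgHom ℂ⟦X⟧ _ (RingQuot.mkAlgHom ℂ⟦X⟧ (AtRel A d) (freeGen i k))

/-- Reduction modulo `ħ`. -/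
def modHbar {B : Type} [Ring B] [Algebra ℂ⟦X⟧ B] : B →ₐ[ℂ⟦X⟧] ModHbar B :=
  RingQuot.mkAlgHom ℂ⟦X⟧ (HbarRel B)

end QuantumCurrent

end

/-! Classical limits. The relation `(z - w)[x_i(z), x_j(w)] = 0` says that `[x_i[k], x_j[l]]`
depends only on `k + l`. Antisymmetry then makes the `x_i[k]` with `i` fixed commute, and all Serre
relations of F̃₊ reduce to `ad(x_i[0])^m (x_j[l]) = 0`, `m = 1 - a_ij`. Modulo ħ one has `q = 1` and
the q-binomials are binomials: the vertex relations become the current relations, the Serre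
relations of the second algebra become `± ad(x_i[0])^m (x_j[l])`, and the symmetrized ones become `±
m!` times such elements. Both limits therefore have the presentation of U(F̃₊)
(`exists_limit_equiv`); dividing by ⋂ ħ^N B does not affect B / ħB.

Roots and kernel. F̃₊ is treated as the positive half of a larger loop algebra. The missing operator
`[f_i[0], ·]` is constructed as a cocycle with values in F̃₊ extended by elements `h_i[k]`
(`exists_lower`). Away from degree ε_i it forms, together with `ad x_i[0]`, strings of 𝔰𝔩₂ weight
spaces on which both operators are locally nilpotent. Hence a nonzero vector of degree α ≠ ε_i can
be moved to a nonzero vector of degree s_i α (`IsSl2String.eq_zero_of_E_pow`). The same argument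
holds in 𝔤, and an induction on the height shows that each degree of F̃₊ is a root of 𝔤
(`rootSpace_ne_bot`). The induction starts from `e_i ≠ 0`, which follows from `gen_h_ne_zero`,
proved on a highest weight module.

Raising and lowering preserve the kernel of the morphism to the loop algebra of 𝔤, so the degrees in
which j₊ is not injective are stable under the Weyl group (`IsKerDegree.reflection`). No ε_i is
among them, because `e_i ⊗ t^k ≠ 0`; hence no real root is. Finally the Cartan subalgebra separates
degrees, so a kernel element has its homogeneous components in the kernel of the map to the loop
algebra of 𝔤, which gives `ker_toLnPlus_le`. -/

noncomputable section

attribute [local instance 100] LieRing.ofAssociativeRing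

/-! ### Presentations of Lie algebras -/

namespace LieIdeal

variable {L L' : Type*} [LieRing L] [LieAlgebra ℂ L] [LieRing L'] [LieAlgebra ℂ L']

/-- The quotient map by a Lie ideal, as a morphism of Lie algebras. -/
def mkHom (I : LieIdeal ℂ L) : L →ₗ⁅ℂ⁆ L ⧸ I :=
  { (LieSubmodule.Quotient.mk' I : L →ₗ[ℂ] L ⧸ I) with
    map_lie' := by intro x y; rfl }

theorem mkHom_surjective (I : LieIdeal ℂ L) : Function.Surjective I.mkHom :=
  LieSubmodule.Quotient.surjective_mk' I

theorem mkHom_eq_zero {I : LieIdeal ℂ L} {x : L} (hx : x ∈ I) : I.mkHom x = 0 :=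
  (LieSubmodule.Quotient.mk_eq_zero (N := I)).2 hx

/-- A linear map that vanishes on a Lie ideal factors through the quotient. -/
def liftLinear {M : Type*} [AddCommGroup M] [Module ℂ M] (I : LieIdeal ℂ L) (f : L →ₗ[ℂ] M)
    (h : ∀ x ∈ I, f x = 0) : (L ⧸ I) →ₗ[ℂ] M :=
  I.toSubmodule.liftQ f (fun x hx => h x hx)

theorem liftLinear_mkHom {M : Type*} [AddCommGroup M] [Module ℂ M] (I : LieIdeal ℂ L)
    (f : L →ₗ[ℂ] M) (h : ∀ x ∈ I, f x = 0) (x : L) : I.liftLinear f h (I.mkHom x) = f x := rfl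

/-- A morphism of Lie algebras that vanishes on a Lie ideal factors through the quotient. -/
def liftHom (I : LieIdeal ℂ L) (f : L →ₗ⁅ℂ⁆ L') (h : ∀ x ∈ I, f x = 0) : (L ⧸ I) →ₗ⁅ℂ⁆ L' :=
  { I.liftLinear (f : L →ₗ[ℂ] L') h with
    map_lie' := by
      intro x y
      obtain ⟨x, rfl⟩ := I.mkHom_surjective x
      obtain ⟨y, rfl⟩ := I.mkHom_surjective y
      exact f.map_lie x y }

theorem liftHom_mkHom (I : LieIdeal ℂ L) (f : L →ₗ⁅ℂ⁆ L') (h : ∀ x ∈ I, f x = 0) (x : L) :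
    I.liftHom f h (I.mkHom x) = f x := rfl

end LieIdeal

theorem LieHom.eq_zero_of_mem_lieSpan {L L' : Type*} [LieRing L] [LieAlgebra ℂ L] [LieRing L']
    [LieAlgebra ℂ L'] (f : L →ₗ⁅ℂ⁆ L') {R : Set L} (h : ∀ x ∈ R, f x = 0) :
    ∀ x ∈ (LieSubmodule.lieSpan ℂ L R : LieIdeal ℂ L), f x = 0 := by
  intro x hx
  have : (LieSubmodule.lieSpan ℂ L R : LieIdeal ℂ L) ≤ f.ker :=
    LieSubmodule.lieSpan_le.2 fun y hy => (LieHom.mem_ker).2 (h y hy)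
  exact LieHom.mem_ker.1 (this hx)

theorem LieHom.map_ad_pow {L L' : Type*} [LieRing L] [LieAlgebra ℂ L] [LieRing L']
    [LieAlgebra ℂ L'] (f : L →ₗ⁅ℂ⁆ L') (x y : L) (m : ℕ) :
    f ((LieAlgebra.ad ℂ L x ^ m) y) = (LieAlgebra.ad ℂ L' (f x) ^ m) (f y) := by
  induction m with
  | zero => rfl
  | succ m ih => simp [pow_succ', ih]

/-- The generators define a morphism to `K`; followed by the inclusion it is the identity, so every
element lies in `K`. -/
theorem FreeLieAlgebra.mem_of_forall_of_mem {X : Type*} (K : LieSubalgebra ℂ (FreeLieAlgebra ℂ X))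
    (h : ∀ x, FreeLieAlgebra.of ℂ x ∈ K) (u : FreeLieAlgebra ℂ X) : u ∈ K := by
  let g : FreeLieAlgebra ℂ X →ₗ⁅ℂ⁆ K := FreeLieAlgebra.lift ℂ fun x => ⟨_, h x⟩
  have hg : K.incl.comp g = LieHom.id := by
    ext x
    simp [g]
  have := congrArg (fun φ => φ u) hg
  simp only [LieHom.comp_apply, LieHom.id_apply] at this
  rw [← this]
  exact (g u).2

/-- A Lie subalgebra of a quotient of a free Lie algebra that contains the generators is
everything. -/
theorem FreeLieAlgebra.mem_of_forall_mk_mem {X : Type*} (I : LieIdeal ℂ (FreeLieAlgebra ℂ X))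
    (K : LieSubalgebra ℂ (FreeLieAlgebra ℂ X ⧸ I))
    (h : ∀ x, I.mkHom (FreeLieAlgebra.of ℂ x) ∈ K) (u : FreeLieAlgebra ℂ X ⧸ I) : u ∈ K := by
  obtain ⟨u, rfl⟩ := I.mkHom_surjective u
  exact FreeLieAlgebra.mem_of_forall_of_mem (K.comap I.mkHom) h u

/-! ### Cocycles on presented Lie algebras -/

section Cocycle

variable {X L M : Type*} [LieRing L] [LieAlgebra ℂ L] [AddCommGroup M] [Module ℂ M]

/-- The semidirect product of `L` with `M` acts on `M × ℂ`: the pair `(y, m)` sends `(v, c)` to `(y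
v + c m, 0)`. Lifting `x ↦ (π x, φ x)` to the free Lie algebra, `D u` is the `M`-component of the
image of `u`, read off at `(0, 1)`, and the cocycle identity is the formula for the bracket. -/
theorem FreeLieAlgebra.exists_cocycle (π : FreeLieAlgebra ℂ X →ₗ⁅ℂ⁆ L)
    (a : L →ₗ⁅ℂ⁆ Module.End ℂ M) (φ : X → M) :
    ∃ D : FreeLieAlgebra ℂ X →ₗ[ℂ] M, (∀ x, D (FreeLieAlgebra.of ℂ x) = φ x) ∧
      ∀ u v, D ⁅u, v⁆ = a (π u) (D v) - a (π v) (D u) := by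
  let act : L → M → Module.End ℂ (M × ℂ) := fun y m =>
    (LinearMap.inl ℂ M ℂ) ∘ₗ ((a y) ∘ₗ LinearMap.fst ℂ M ℂ +
      (LinearMap.toSpanSingleton ℂ M m) ∘ₗ LinearMap.snd ℂ M ℂ)
  have hact : ∀ y m p, act y m p = (a y p.1 + p.2 • m, 0) := fun y m p => rfl
  let g : FreeLieAlgebra ℂ X →ₗ⁅ℂ⁆ Module.End ℂ (M × ℂ) :=
    FreeLieAlgebra.lift ℂ fun x => act (π (FreeLieAlgebra.of ℂ x)) (φ x)
  let K : LieSubalgebra ℂ (FreeLieAlgebra ℂ X) :=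
    { carrier := {u | ∃ m, g u = act (π u) m}
      add_mem' := by
        rintro u v ⟨m, hm⟩ ⟨m', hm'⟩
        refine ⟨m + m', LinearMap.ext fun p => ?_⟩
        rw [map_add, hm, hm', LinearMap.add_apply, hact, hact, hact]
        simp only [map_add, LinearMap.add_apply, smul_add, Prod.mk_add_mk, add_zero]
        congr 1
        abel
      zero_mem' := ⟨0, LinearMap.ext fun p => by simp [hact, Prod.zero_eq_mk]⟩
      smul_mem' := by
        rintro c u ⟨m, hm⟩
        refine ⟨c • m, LinearMap.ext fun p => ?_⟩
        rw [map_smul, hm, LinearMap.smul_apply, hact, hact]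
        simp [smul_comm c p.2 m]
      lie_mem' := by
        rintro u v ⟨m, hm⟩ ⟨m', hm'⟩
        refine ⟨a (π u) m' - a (π v) m, LinearMap.ext fun p => ?_⟩
        rw [LieHom.map_lie, hm, hm', LieRing.of_associative_ring_bracket, LinearMap.sub_apply,
          Module.End.mul_apply, Module.End.mul_apply]
        simp only [hact, LieHom.map_lie, LieRing.of_associative_ring_bracket, LinearMap.sub_apply,
          Module.End.mul_apply, map_add, map_smul, zero_smul, add_zero, Prod.mk_sub_mk, sub_zero,
          smul_sub]
        congr 1
        abel }
  have hK : ∀ u, ∃ m, g u = act (π u) m := fun u =>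
    FreeLieAlgebra.mem_of_forall_of_mem K (fun x => ⟨φ x, by simp [g]⟩) u
  refine ⟨{ toFun := fun u => (g u (0, 1)).1
            map_add' := fun u v => by simp
            map_smul' := fun c u => by simp }, fun x => ?_, fun u v => ?_⟩
  · simp [g, hact]
  · obtain ⟨m, hm⟩ := hK u
    obtain ⟨m', hm'⟩ := hK v
    simp only [LinearMap.coe_mk, AddHom.coe_mk, LieHom.map_lie, hm, hm',
      LieRing.of_associative_ring_bracket, LinearMap.sub_apply, Module.End.mul_apply, hact]
    simp

/-- Elements of `I` act by zero on `M`, so the cocycle identity makes `I ∩ ker D` an ideal. It is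
all of `I` once `D` vanishes on the relators. -/
theorem FreeLieAlgebra.exists_cocycle_quotient (R : Set (FreeLieAlgebra ℂ X))
    (I : LieIdeal ℂ (FreeLieAlgebra ℂ X)) (hI : I = LieSubmodule.lieSpan ℂ _ R)
    (a : (FreeLieAlgebra ℂ X ⧸ I) →ₗ⁅ℂ⁆ Module.End ℂ M) (φ : X → M)
    (h : ∀ D : FreeLieAlgebra ℂ X →ₗ[ℂ] M, (∀ x, D (FreeLieAlgebra.of ℂ x) = φ x) →
      (∀ u v, D ⁅u, v⁆ = a (I.mkHom u) (D v) - a (I.mkHom v) (D u)) → ∀ r ∈ R, D r = 0) :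
    ∃ D : (FreeLieAlgebra ℂ X ⧸ I) →ₗ[ℂ] M,
      (∀ x, D (I.mkHom (FreeLieAlgebra.of ℂ x)) = φ x) ∧
      ∀ u v, D ⁅u, v⁆ = a u (D v) - a v (D u) := by
  obtain ⟨D, hD, hD'⟩ := FreeLieAlgebra.exists_cocycle I.mkHom a φ
  let N : LieIdeal ℂ (FreeLieAlgebra ℂ X) :=
    { I.toSubmodule ⊓ LinearMap.ker D with
      lie_mem := by
        rintro u v ⟨hv, hv'⟩
        refine ⟨I.lie_mem hv, ?_⟩
        change D v = 0 at hv'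
        change D ⁅u, v⁆ = 0
        rw [hD', hv', LieIdeal.mkHom_eq_zero (I := I) hv]
        simp }
  have hle : I ≤ N := hI ▸ LieSubmodule.lieSpan_le.2 fun r hr =>
    ⟨hI ▸ LieSubmodule.subset_lieSpan hr, h D hD hD' r hr⟩
  have h0 : ∀ u ∈ I, D u = 0 := fun u hu => (hle hu).2
  refine ⟨I.liftLinear D h0, fun x => ?_, fun u v => ?_⟩
  · rw [LieIdeal.liftLinear_mkHom, hD]
  · obtain ⟨u, rfl⟩ := I.mkHom_surjective u
    obtain ⟨v, rfl⟩ := I.mkHom_surjective v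
    rw [← LieHom.map_lie, LieIdeal.liftLinear_mkHom, LieIdeal.liftLinear_mkHom,
      LieIdeal.liftLinear_mkHom, hD']

end Cocycle

/-! ### Strings of weight spaces for `𝔰𝔩₂` -/

section Strings

variable {V : Type*} [AddCommGroup V] [Module ℂ V]

/-- `P r`, `r ∈ ℤ`, is a string of weight spaces, of weights `μ + 2 r`, for operators `E`, `F`. -/
structure IsSl2String (P : ℤ → Submodule ℂ V) (E F : Module.End ℂ V) (μ : ℤ) : Prop where
  mapE : ∀ r, ∀ x ∈ P r, E x ∈ P (r + 1)
  mapF : ∀ r, ∀ x ∈ P r, F x ∈ P (r - 1)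
  comm : ∀ r, ∀ x ∈ P r, E (F x) - F (E x) = ((μ + 2 * r : ℤ) : ℂ) • x

namespace IsSl2String

variable {P : ℤ → Submodule ℂ V} {E F : Module.End ℂ V} {μ : ℤ}

theorem swap (h : IsSl2String P E F μ) : IsSl2String (fun r => P (-r)) F E (-μ) where
  mapE r x hx := by
    have := h.mapF _ x hx
    rwa [show -r - 1 = -(r + 1) by ring] at this
  mapF r x hx := by
    have := h.mapE _ x hx
    rwa [show -r + 1 = -(r - 1) by ring] at this
  comm r x hx := by
    rw [← neg_sub, h.comm _ x hx, ← neg_smul]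
    push_cast
    ring_nf

theorem pow_mem (h : IsSl2String P E F μ) {r : ℤ} {x : V} (hx : x ∈ P r) (k : ℕ) :
    (E ^ k) x ∈ P (r + k) := by
  induction k with
  | zero => simpa using hx
  | succ k ih =>
    rw [pow_succ', Module.End.mul_apply]
    have := h.mapE _ _ ih
    rwa [show r + (k : ℤ) + 1 = r + ((k + 1 : ℕ) : ℤ) by push_cast; ring] at this

/-- `F E` stabilizes the weight spaces. -/
theorem FE_mem (h : IsSl2String P E F μ) {r : ℤ} {x : V} (hx : x ∈ P r) : F (E x) ∈ P r := by
  simpa using h.mapF _ _ (h.mapE _ _ hx)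

/-- Moving `F E` past each factor `E` costs the weight of the vector reached; the weights `μ + 2, …,
μ + 2k` add up to `k (μ + k + 1)`. -/
theorem FE_E_pow (h : IsSl2String P E F μ) {x : V} (hx : x ∈ P 0) (k : ℕ) :
    F (E ((E ^ k) x)) = (E ^ k) (F (E x) - ((k * (μ + k + 1) : ℤ) : ℂ) • x) := by
  induction k generalizing x with
  | zero => simp
  | succ k ih =>
    have h1 := h.comm _ _ (h.pow_mem hx (k + 1))
    have hE : ∀ y, E ((E ^ k) y) = (E ^ (k + 1)) y := fun y => by
      rw [pow_succ', Module.End.mul_apply]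
    have h2 := congrArg E (ih hx)
    rw [hE, hE] at h2
    rw [h2, sub_eq_iff_eq_add, ← sub_eq_iff_eq_add'] at h1
    rw [← h1]
    simp only [map_sub, map_smul]
    push_cast
    module

/-- On a weight space `F ^ k E ^ k` is a polynomial in `F E` with known roots. Comparing it with the
analogous polynomial for `E ^ l F ^ l` is the core of `eq_zero_of_E_pow`. -/
theorem F_pow_E_pow (h : IsSl2String P E F μ) {x : V} (hx : x ∈ P 0) (k : ℕ) :
    (F ^ k) ((E ^ k) x) =
      ((List.range k).map fun r : ℕ => F * E - ((r * (μ + r + 1) : ℤ) : ℂ) • (1 : Module.End ℂ V)).prod x := by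
  induction k generalizing x with
  | zero => simp
  | succ k ih =>
    rw [List.range_succ, List.map_append, List.prod_append, Module.End.mul_apply, pow_succ,
      Module.End.mul_apply, pow_succ' E, Module.End.mul_apply, h.FE_E_pow hx, ih]
    · simp
    · exact Submodule.sub_mem _ (h.FE_mem hx) (Submodule.smul_mem _ _ hx)

end IsSl2String

/-- Products of `T - a` for `a` in two disjoint lists cannot have a common kernel. -/
theorem Module.End.eq_zero_of_prod_sub_eq_zero (T : Module.End ℂ V) (l l' : List ℂ)
    (hl : ∀ a ∈ l, ∀ b ∈ l', a ≠ b) (v : V)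
    (h : (l.map fun a => T - a • (1 : Module.End ℂ V)).prod v = 0)
    (h' : (l'.map fun a => T - a • (1 : Module.End ℂ V)).prod v = 0) : v = 0 := by
  have key : ∀ l : List ℂ, (l.map fun a => T - a • (1 : Module.End ℂ V)).prod =
      Polynomial.aeval T (l.map fun a => Polynomial.X - Polynomial.C a).prod := by
    intro l
    rw [map_list_prod, List.map_map]
    congr 2
    funext a
    simp [Algebra.algebraMap_eq_smul_one]
  have hcop : IsCoprime (l.map fun a => Polynomial.X - Polynomial.C a).prod
      (l'.map fun a => Polynomial.X - Polynomial.C a).prod := by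
    refine List.prod_induction (fun p => IsCoprime p _) (fun _ _ => IsCoprime.mul_left) isCoprime_one_left ?_
    simp only [List.mem_map]
    rintro _ ⟨a, ha, rfl⟩
    refine List.prod_induction (fun p => IsCoprime _ p) (fun _ _ => IsCoprime.mul_right) isCoprime_one_right ?_
    simp only [List.mem_map]
    rintro _ ⟨b, hb, rfl⟩
    exact Polynomial.isCoprime_X_sub_C_of_isUnit_sub (sub_ne_zero.2 (hl a ha b hb)).isUnit
  rw [key] at h h'
  -- A Bézout relation between the two polynomials, evaluated at `T` and applied to `v`, reads `0 =
  -- v`.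
  obtain ⟨p, q, hpq⟩ := hcop
  have := congrArg (fun r => Polynomial.aeval T r v) hpq
  simpa [h, h'] using this.symm

/-- On a string, a vector of weight `-m` that is annihilated by a power of `F` is not annihilated
by `E ^ k` with `k ≤ m`. -/
theorem IsSl2String.eq_zero_of_E_pow {P : ℤ → Submodule ℂ V} {E F : Module.End ℂ V} {m : ℕ}
    (h : IsSl2String P E F (-m)) {v : V} (hv : v ∈ P 0) {k l : ℕ} (hk : k ≤ m)
    (hE : (E ^ k) v = 0) (hF : (F ^ l) v = 0) : v = 0 := by
  -- For `m = 0` also `k = 0`; the comparison of roots below uses `m > 0`.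
  rcases Nat.eq_zero_or_pos m with rfl | hm
  · obtain rfl : k = 0 := by omega
    simpa using hE
  have h1 := h.F_pow_E_pow hv k
  have h2 := h.swap.F_pow_E_pow (by simpa using hv) l
  rw [hE, map_zero] at h1
  rw [hF, map_zero] at h2
  have hP : ∀ x ∈ P 0, (E * F) x = (F * E - ((m : ℤ) : ℂ) • (1 : Module.End ℂ V)) x := by
    intro x hx
    have := h.comm 0 x hx
    rw [sub_eq_iff_eq_add'] at this
    rw [Module.End.mul_apply, this]
    simp [sub_eq_add_neg]
  -- On `P 0` one has `E F = F E - m`, so the roots `r (m + r + 1)` for `E F` become `m + r (m + r +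
  -- 1)` for `F E`.
  have h3 : ∀ l : List ℕ, ∀ x ∈ P 0, 
      (l.map fun r : ℕ => E * F - ((r * (- -(m : ℤ) + r + 1) : ℤ) : ℂ) • (1 : Module.End ℂ V)).prod x =
      (l.map fun r : ℕ => F * E - ((m + r * (m + r + 1) : ℤ) : ℂ) • (1 : Module.End ℂ V)).prod x ∧
      (l.map fun r : ℕ => F * E - ((m + r * (m + r + 1) : ℤ) : ℂ) • (1 : Module.End ℂ V)).prod x ∈ P 0 := by
    intro l x hx
    induction l with
    | nil => simpa using hx
    | cons r l ih =>
      simp only [List.map_cons, List.prod_cons, Module.End.mul_apply]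
      rw [ih.1]
      refine ⟨?_, Submodule.sub_mem _ (h.FE_mem ih.2) (Submodule.smul_mem _ _ ih.2)⟩
      rw [LinearMap.sub_apply, hP _ ih.2]
      simp only [LinearMap.sub_apply, LinearMap.smul_apply, Module.End.one_apply]
      push_cast
      module
  rw [(h3 _ v hv).1] at h2
  refine Module.End.eq_zero_of_prod_sub_eq_zero (F * E)
    ((List.range k).map fun r : ℕ => ((r * (-m + r + 1) : ℤ) : ℂ))
    ((List.range l).map fun r : ℕ => ((m + r * (m + r + 1) : ℤ) : ℂ)) ?_ v ?_ ?_
  -- The roots `r (r + 1 - m)` with `r < k ≤ m` are nonpositive, those of the other family are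
  -- positive.
  · simp only [List.mem_map, List.mem_range]
    rintro _ ⟨r, hr, rfl⟩ _ ⟨s, hs, rfl⟩ h
    have h := Int.cast_injective h
    have h4 : (r : ℤ) * (-m + r + 1) ≤ 0 :=
      mul_nonpos_of_nonneg_of_nonpos (by positivity) (by omega)
    have h5 : 0 < (m : ℤ) + s * (m + s + 1) := by positivity
    omega
  · rw [List.map_map]
    exact h1.symm
  · rw [List.map_map]
    exact h2.symm

/-- On a string, a vector of weight `m` that is annihilated by a power of `E` is not annihilated
by `F ^ k` with `k ≤ m`. -/
theorem IsSl2String.eq_zero_of_F_pow {P : ℤ → Submodule ℂ V} {E F : Module.End ℂ V} {m : ℕ}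
    (h : IsSl2String P E F m) {v : V} (hv : v ∈ P 0) {k l : ℕ} (hk : k ≤ m)
    (hF : (F ^ k) v = 0) (hE : (E ^ l) v = 0) : v = 0 :=
  h.swap.eq_zero_of_E_pow (by simpa using hv) hk hF hE

end Strings

/-! ### Simultaneous eigenvectors -/

/-- If a subspace is stable under operators that separate the simultaneous eigenvectors `x a`, then
it contains the `x a` as soon as it contains their sum. -/
theorem Submodule.mem_of_sum_eigenvectors_mem {V ι κ : Type*} [AddCommGroup V] [Module ℂ V]
    (N : Submodule ℂ V) (T : κ → Module.End ℂ V) (hT : ∀ k, ∀ x ∈ N, T k x ∈ N) (w : κ → ι → ℂ)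
    (hw : ∀ a b, (∀ k, w k a = w k b) → a = b) (s : Finset ι) (x : ι → V)
    (hx : ∀ a ∈ s, ∀ k, T k (x a) = w k a • x a) (hs : ∑ a ∈ s, x a ∈ N) :
    ∀ a ∈ s, x a ∈ N := by
  classical
  induction s using Finset.induction_on generalizing x with
  | empty => simp
  | insert b s hb ih =>
    have hmem : ∀ a ∈ s, x a ∈ N := by
      intro a ha
      have hab : a ≠ b := fun h => hb (h ▸ ha)
      obtain ⟨k, hk⟩ : ∃ k, w k a ≠ w k b := by
        by_contra! h
        exact hab (hw a b h)
      -- Applying `T k - w k b` removes `x b` from the sum and multiplies `x a` by a nonzero scalar.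
      have h1 : ∑ c ∈ s, (w k c - w k b) • x c ∈ N := by
        have h2 := N.sub_mem (hT k _ hs) (N.smul_mem (w k b) hs)
        rw [map_sum, Finset.smul_sum, ← Finset.sum_sub_distrib, Finset.sum_insert hb,
          hx b (by simp), sub_self, zero_add] at h2
        convert h2 using 1
        refine Finset.sum_congr rfl fun c hc => ?_
        rw [hx c (by simp [hc]), sub_smul]
      have h3 := ih (fun c => (w k c - w k b) • x c)
        (fun c hc l => by rw [map_smul, hx c (by simp [hc]), smul_comm]) h1 a ha
      exact (N.smul_mem_iff (sub_ne_zero.2 hk)).1 h3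
    intro a ha
    rcases Finset.mem_insert.1 ha with rfl | ha
    · rw [Finset.sum_insert hb] at hs
      exact (N.add_mem_iff_left (N.sum_mem hmem)).1 hs
    · exact hmem a ha

/-! ### Families of currents -/

section Current

variable {ι L : Type*} [LieRing L]

/-- The relations `(z - w)[x_i(z), x_j(w)] = 0`. -/
def IsCurrentFamily (x : ι → ℤ → L) : Prop :=
  ∀ i j k l, ⁅x i (k + 1), x j l⁆ = ⁅x i k, x j (l + 1)⁆

namespace IsCurrentFamily

variable {x : ι → ℤ → L}

theorem lie_eq (hx : IsCurrentFamily x) (i j : ι) (k l : ℤ) :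
    ⁅x i k, x j l⁆ = ⁅x i 0, x j (k + l)⁆ := by
  induction k generalizing l with
  | zero => simp
  | succ k ih => rw [hx, ih, add_right_comm, add_assoc]
  | pred k ih =>
    have := hx i j (-k - 1) (l - 1)
    rw [sub_add_cancel, sub_add_cancel, ih] at this
    rw [← this]
    congr 2
    ring

variable [LieAlgebra ℂ L]

/-- By `lie_eq` the bracket is symmetric in `k` and `l`, and it is antisymmetric as well. -/
theorem lie_self (hx : IsCurrentFamily x) (i : ι) (k l : ℤ) : ⁅x i k, x i l⁆ = 0 := by
  have h : ⁅x i k, x i l⁆ = -⁅x i k, x i l⁆ := by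
    conv_lhs => rw [hx.lie_eq, add_comm, ← hx.lie_eq, ← lie_skew]
  have h2 : (2 : ℂ) • ⁅x i k, x i l⁆ = 0 := by
    rw [two_smul]
    nth_rewrite 2 [h]
    exact add_neg_cancel _
  exact (smul_eq_zero.1 h2).resolve_left two_ne_zero

theorem lie_lie_comm (hx : IsCurrentFamily x) (i : ι) (k l : ℤ) (y : L) :
    ⁅x i k, ⁅x i l, y⁆⁆ = ⁅x i l, ⁅x i k, y⁆⁆ := by
  rw [leibniz_lie, hx.lie_self, zero_lie, zero_add]

/-- The operators `ad (x i k)`, `k ∈ ℤ`, commute, so the mode `k` can be carried inward to the last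
argument. Iterating this reduces Serre relations with arbitrary modes to those with `x i 0`. -/
theorem lie_ad_pow (hx : IsCurrentFamily x) (i j : ι) (r : ℕ) (k l : ℤ) :
    ⁅x i k, (LieAlgebra.ad ℂ L (x i 0) ^ r) (x j l)⁆ =
      (LieAlgebra.ad ℂ L (x i 0) ^ (r + 1)) (x j (k + l)) := by
  induction r with
  | zero => simpa using hx.lie_eq i j k l
  | succ r ih =>
    rw [pow_succ', Module.End.mul_apply, LieAlgebra.ad_apply, hx.lie_lie_comm, ih,
      pow_succ' _ (r + 1), Module.End.mul_apply, LieAlgebra.ad_apply]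

theorem foldr_eq (hx : IsCurrentFamily x) (i j : ι) (ks : List ℤ) (l : ℤ) :
    ks.foldr (fun s y => ⁅x i s, y⁆) (x j l) =
      (LieAlgebra.ad ℂ L (x i 0) ^ ks.length) (x j (ks.sum + l)) := by
  induction ks with
  | nil => simp
  | cons k ks ih => rw [List.foldr_cons, ih, hx.lie_ad_pow, List.sum_cons, List.length_cons,
      add_assoc]

end IsCurrentFamily

end Current

namespace FPlus

variable {n : ℕ} {A : Matrix (Fin n) (Fin n) ℤ}

/-! ### The universal property -/

/-- The ideal of relations of `F̃₊`. -/
abbrev relIdeal (A : Matrix (Fin n) (Fin n) ℤ) : LieIdeal ℂ (FreeLieAlgebra ℂ (Fin n × ℤ)) :=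
  LieSubmodule.lieSpan ℂ (FreeLieAlgebra ℂ (Fin n × ℤ)) {x | LoopRel A x}

theorem gen_eq (i : Fin n) (k : ℤ) : gen A i k = (relIdeal A).mkHom (freeX i k) := rfl

theorem isCurrentFamily_gen : IsCurrentFamily (gen A) := by
  intro i j k l
  rw [← sub_eq_zero]
  exact LieIdeal.mkHom_eq_zero (I := relIdeal A)
    (LieSubmodule.subset_lieSpan (LoopRel.current i j k l))

theorem map_foldr {L : Type*} [LieRing L] [LieAlgebra ℂ L]
    (f : FreeLieAlgebra ℂ (Fin n × ℤ) →ₗ⁅ℂ⁆ L) (i j : Fin n) (ks : List ℤ) (l : ℤ) :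
    f (ks.foldr (fun s y => ⁅freeX i s, y⁆) (freeX j l)) =
      ks.foldr (fun s y => ⁅f (freeX i s), y⁆) (f (freeX j l)) := by
  induction ks with
  | nil => rfl
  | cons k ks ih => simp only [List.foldr_cons, LieHom.map_lie, ih]

theorem mkHom_foldr (i j : Fin n) (ks : List ℤ) (l : ℤ) :
    (relIdeal A).mkHom (ks.foldr (fun s y => ⁅freeX i s, y⁆) (freeX j l)) =
      (LieAlgebra.ad ℂ (FPlus A) (gen A i 0) ^ ks.length) (gen A j (ks.sum + l)) := by
  rw [map_foldr]
  exact isCurrentFamily_gen.foldr_eq i j ks l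

theorem ad_pow_gen {i j : Fin n} (hij : i ≠ j) (l : ℤ) :
    (LieAlgebra.ad ℂ (FPlus A) (gen A i 0) ^ serreLen A i j) (gen A j l) = 0 := by
  have := LieIdeal.mkHom_eq_zero (I := relIdeal A)
    (LieSubmodule.subset_lieSpan (LoopRel.serre i j hij (fun _ => 0) l))
  rw [mkHom_foldr] at this
  simpa using this

variable (A) in
/-- The universal property of `F̃₊`. -/
def lift {L : Type*} [LieRing L] [LieAlgebra ℂ L] (x : Fin n → ℤ → L) (hx : IsCurrentFamily x)
    (hs : ∀ i j, i ≠ j → ∀ l, (LieAlgebra.ad ℂ L (x i 0) ^ serreLen A i j) (x j l) = 0) :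
    FPlus A →ₗ⁅ℂ⁆ L :=
  (relIdeal A).liftHom (FreeLieAlgebra.lift ℂ fun p => x p.1 p.2) (by
    apply LieHom.eq_zero_of_mem_lieSpan
    rintro _ (⟨i, j, k, l⟩ | ⟨i, j, hij, k, l⟩)
    · simp [freeX, hx i j k l]
    · rw [map_foldr]
      simp only [freeX, FreeLieAlgebra.lift_of_apply]
      rw [hx.foldr_eq, List.length_ofFn, hs i j hij])

theorem lift_gen {L : Type*} [LieRing L] [LieAlgebra ℂ L] (x : Fin n → ℤ → L)
    (hx : IsCurrentFamily x)
    (hs : ∀ i j, i ≠ j → ∀ l, (LieAlgebra.ad ℂ L (x i 0) ^ serreLen A i j) (x j l) = 0)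
    (i : Fin n) (k : ℤ) : lift A x hx hs (gen A i k) = x i k := by
  rw [lift, gen_eq, LieIdeal.liftHom_mkHom, freeX, FreeLieAlgebra.lift_of_apply]

theorem mem_of_gen_mem (K : LieSubalgebra ℂ (FPlus A)) (h : ∀ i k, gen A i k ∈ K) (u : FPlus A) :
    u ∈ K :=
  FreeLieAlgebra.mem_of_forall_mk_mem (relIdeal A) K (fun p => h p.1 p.2) u

theorem hom_ext {L : Type*} [LieRing L] [LieAlgebra ℂ L] {f g : FPlus A →ₗ⁅ℂ⁆ L}
    (h : ∀ i k, f (gen A i k) = g (gen A i k)) : f = g := by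
  ext u
  let K : LieSubalgebra ℂ (FPlus A) :=
    { LinearMap.eqLocus (f : FPlus A →ₗ[ℂ] L) (g : FPlus A →ₗ[ℂ] L) with
      lie_mem' := by
        intro u v hu hv
        change f u = g u at hu
        change f v = g v at hv
        change f ⁅u, v⁆ = g ⁅u, v⁆
        rw [LieHom.map_lie, LieHom.map_lie, hu, hv] }
  exact mem_of_gen_mem K h u

/-! ### Derivations of `F̃₊` -/

/-- A nested bracket depends on its modes only through their sum. The prescribed cocycle multiplies
it by a scalar and shifts that sum by `s`, so it vanishes on relators. -/
theorem exists_deriv (A : Matrix (Fin n) (Fin n) ℤ) (c : Fin n → ℂ) (s : ℤ) :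
    ∃ D : Module.End ℂ (FPlus A), (∀ j l, D (gen A j l) = c j • gen A j (l + s)) ∧
      ∀ u v, D ⁅u, v⁆ = ⁅u, D v⁆ - ⁅v, D u⁆ := by
  obtain ⟨D, hD, hD'⟩ := FreeLieAlgebra.exists_cocycle_quotient _ (relIdeal A) rfl
    (LieAlgebra.ad ℂ (FPlus A)) (fun p => c p.1 • gen A p.1 (p.2 + s)) (by
      intro D hD hD'
      have hX : ∀ j l, D (freeX j l) = c j • gen A j (l + s) := fun j l => hD (j, l)
      simp only [LieAlgebra.ad_apply] at hD'
      have hc : ∀ i j k l, D ⁅freeX i k, freeX j l⁆ =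
          (c j + c i) • ⁅gen A i 0, gen A j (k + l + s)⁆ := by
        intro i j k l
        rw [hD', hX, hX, ← gen_eq, ← gen_eq, lie_smul, lie_smul, ← lie_skew (gen A j l), smul_neg,
          sub_neg_eq_add, isCurrentFamily_gen.lie_eq, isCurrentFamily_gen.lie_eq i j (k + s),
          add_smul]
        congr 4 <;> ring
      rintro _ (⟨i, j, k, l⟩ | ⟨i, j, hij, k, l⟩)
      · rw [map_sub, hc, hc, sub_eq_zero]
        congr 3
        ring
      · have key : ∀ ks : List ℤ, D (ks.foldr (fun s y => ⁅freeX i s, y⁆) (freeX j l)) =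
            (c j + ks.length * c i) •
              (LieAlgebra.ad ℂ (FPlus A) (gen A i 0) ^ ks.length) (gen A j (ks.sum + l + s)) := by
          intro ks
          induction ks with
          | nil => simp [hX]
          | cons k ks ih =>
            rw [List.foldr_cons, hD', ih, mkHom_foldr, ← gen_eq, hX, lie_smul, lie_smul,
              ← lie_skew _ (gen A i _), isCurrentFamily_gen.lie_ad_pow, isCurrentFamily_gen.lie_ad_pow,
              List.length_cons, List.sum_cons, smul_neg, sub_neg_eq_add,
              show k + s + (ks.sum + l) = k + ks.sum + l + s by ring,
              show k + (ks.sum + l + s) = k + ks.sum + l + s by ring, ← add_smul]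
            congr 1
            push_cast
            ring
        rw [key, List.length_ofFn, ad_pow_gen hij, smul_zero])
  exact ⟨D, fun j l => hD (j, l), hD'⟩

/-- The derivation of `F̃₊` with `x_j[l] ↦ c_j x_j[l + s]`. -/
def deriv (A : Matrix (Fin n) (Fin n) ℤ) (c : Fin n → ℂ) (s : ℤ) : Module.End ℂ (FPlus A) :=
  (exists_deriv A c s).choose

theorem deriv_gen (c : Fin n → ℂ) (s : ℤ) (j : Fin n) (l : ℤ) :
    deriv A c s (gen A j l) = c j • gen A j (l + s) := (exists_deriv A c s).choose_spec.1 j l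

theorem deriv_lie (c : Fin n → ℂ) (s : ℤ) (u v : FPlus A) :
    deriv A c s ⁅u, v⁆ = ⁅u, deriv A c s v⁆ - ⁅v, deriv A c s u⁆ :=
  (exists_deriv A c s).choose_spec.2 u v

theorem deriv_ad_pow (c : Fin n → ℂ) (s : ℤ) (i j : Fin n) (r : ℕ) (l : ℤ) :
    deriv A c s ((LieAlgebra.ad ℂ (FPlus A) (gen A i 0) ^ r) (gen A j l)) =
      (c j + r * c i) • (LieAlgebra.ad ℂ (FPlus A) (gen A i 0) ^ r) (gen A j (s + l)) := by
  induction r with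
  | zero => simp [deriv_gen, add_comm]
  | succ r ih =>
    rw [pow_succ', Module.End.mul_apply, Module.End.mul_apply, LieAlgebra.ad_apply,
      LieAlgebra.ad_apply, deriv_lie, ih, deriv_gen, lie_smul, lie_smul,
      ← lie_skew _ (gen A i _), zero_add, isCurrentFamily_gen.lie_ad_pow,
      isCurrentFamily_gen.lie_ad_pow, zero_add, smul_neg, sub_neg_eq_add, ← add_smul]
    congr 1
    push_cast
    ring

/-- The action of `∑_k c_k h_i[k]`, where `[h_i[k], x_j[l]] = a_ij x_j[k + l]`. -/
def cartan (A : Matrix (Fin n) (Fin n) ℤ) (i : Fin n) :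
    (ℤ →₀ ℂ) →ₗ[ℂ] Module.End ℂ (FPlus A) :=
  Finsupp.linearCombination ℂ fun k => deriv A (fun j => (A i j : ℂ)) k

theorem cartan_single (i : Fin n) (k : ℤ) (t : ℂ) :
    cartan A i (Finsupp.single k t) = t • deriv A (fun j => (A i j : ℂ)) k := by
  simp [cartan]

theorem cartan_lie (i : Fin n) (c : ℤ →₀ ℂ) (u v : FPlus A) :
    cartan A i c ⁅u, v⁆ = ⁅u, cartan A i c v⁆ - ⁅v, cartan A i c u⁆ := by
  induction c using Finsupp.induction_linear with
  | zero => simp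
  | add c d hc hd =>
    simp only [map_add, LinearMap.add_apply, hc, hd, lie_add]
    abel
  | single k t =>
    rw [cartan_single]
    simp [deriv_lie, smul_sub]

/-- The action of `F̃₊` on the vector space spanned by `F̃₊` and elements `h_i[k]`, `k ∈ ℤ`. -/
def extAct (A : Matrix (Fin n) (Fin n) ℤ) (i : Fin n) :
    FPlus A →ₗ⁅ℂ⁆ Module.End ℂ (FPlus A × (ℤ →₀ ℂ)) where
  -- The minus sign is that of `[u, h] = -[h, u]`; brackets have no `h_i[k]` component.
  toFun u := LinearMap.inl ℂ _ _ ∘ₗ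
    ((LieAlgebra.ad ℂ (FPlus A) u) ∘ₗ LinearMap.fst ℂ _ _ -
      ((cartan A i).flip u) ∘ₗ LinearMap.snd ℂ _ _)
  map_add' u v := by
    refine LinearMap.ext fun p => ?_
    simp
    abel
  map_smul' t u := by
    refine LinearMap.ext fun p => ?_
    simp [smul_sub]
  map_lie' {u v} := by
    refine LinearMap.ext fun p => ?_
    rw [LieRing.of_associative_ring_bracket]
    simp [cartan_lie]
    abel

theorem extAct_apply (i : Fin n) (u : FPlus A) (p : FPlus A × (ℤ →₀ ℂ)) :
    extAct A i u p = (⁅u, p.1⁆ - cartan A i p.2 u, 0) := rfl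

/-- This is the operator `[f_i[0], ·]`, determined by `[f_i[0], x_j[l]] = -δ_ij h_i[l]`. The content
is that it kills the Serre relators, for which the two indices are compared with `i`. -/
theorem exists_lower (hA : IsGenCartan A) (i : Fin n) :
    ∃ D : FPlus A →ₗ[ℂ] FPlus A × (ℤ →₀ ℂ),
      (∀ j l, D (gen A j l) = (0, if j = i then Finsupp.single l (-1) else 0)) ∧
      ∀ u v, D ⁅u, v⁆ = extAct A i u (D v) - extAct A i v (D u) := by
  obtain ⟨D, hD, hD'⟩ := FreeLieAlgebra.exists_cocycle_quotient _ (relIdeal A) rfl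
    (extAct A i) (fun p => (0, if p.1 = i then Finsupp.single p.2 (-1) else 0)) (by
      intro D hD hD'
      have hX : ∀ j l, D (freeX j l) = (0, if j = i then Finsupp.single l (-1) else 0) :=
        fun j l => hD (j, l)
      have hX1 : ∀ j l, (D (freeX j l)).1 = 0 := fun j l => by rw [hX]
      have hcart : ∀ j l (r : ℕ) q m, cartan A i (D (freeX j l)).2
          ((LieAlgebra.ad ℂ (FPlus A) (gen A i 0) ^ r) (gen A q m)) =
          (if j = i then (-(A i q + r * A i i) : ℂ) else 0) •
            (LieAlgebra.ad ℂ (FPlus A) (gen A i 0) ^ r) (gen A q (l + m)) := by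
        intro j l r q m
        rw [hX]
        split_ifs with h
        · simp only [cartan_single, LinearMap.smul_apply, deriv_ad_pow]
          module
        · simp
      have hcart0 : ∀ j l q m, cartan A i (D (freeX j l)).2 (gen A q m) =
          (if j = i then (-(A i q) : ℂ) else 0) • gen A q (l + m) := by
        intro j l q m
        simpa using hcart j l 0 q m
      have hlie : ∀ p q k l, D ⁅freeX p k, freeX q l⁆ =
          (-((if q = i then (-(A i p) : ℂ) else 0) • gen A p (k + l)) +
            ((if p = i then (-(A i q) : ℂ) else 0) • gen A q (k + l)), 0) := by
        intro p q k l
        rw [hD', extAct_apply, extAct_apply, hX1, hX1, ← gen_eq, ← gen_eq, hcart0, hcart0,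
          add_comm l k]
        simp
      rintro _ (⟨p, q, k, l⟩ | ⟨p, q, hpq, k, l⟩)
      · rw [map_sub, hlie, hlie, show k + 1 + l = k + (l + 1) by ring, sub_self]
      · by_cases hp : p = i
        · subst hp
          -- The usual 𝔰𝔩₂ computation: the coefficient is zero exactly when needed, at length `1 -
          -- a_pq`.
          have key : ∀ ks : List ℤ, D (ks.foldr (fun s y => ⁅freeX p s, y⁆) (freeX q l)) =
              (-(ks.length * (A p q + ks.length - 1) : ℂ) •
              (LieAlgebra.ad ℂ (FPlus A) (gen A p 0) ^ (ks.length - 1)) (gen A q (ks.sum + l)),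
                0) := by
            intro ks
            induction ks with
            | nil => simp [hX, hpq.symm]
            | cons k ks ih =>
              rw [List.foldr_cons, hD', ih, mkHom_foldr, ← gen_eq, extAct_apply, extAct_apply, hX1,
                hcart, if_pos rfl, lie_smul, isCurrentFamily_gen.lie_ad_pow]
              have h2 : (ks.length : ℂ) • (LieAlgebra.ad ℂ (FPlus A) (gen A p 0) ^
                  (ks.length - 1 + 1)) (gen A q (k + (ks.sum + l))) = (ks.length : ℂ) •
                  (LieAlgebra.ad ℂ (FPlus A) (gen A p 0) ^ ks.length)
                    (gen A q (k + (ks.sum + l))) := by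
                rcases ks with _ | ⟨k', ks⟩
                · simp
                · simp
              rw [mul_comm, ← mul_neg, mul_comm, neg_mul_comm, mul_comm, mul_smul, h2]
              simp only [map_zero, LinearMap.zero_apply, sub_zero, lie_zero, zero_sub,
                Prod.mk_sub_mk, List.length_cons, List.sum_cons, Nat.add_sub_cancel, hA.diag,
                add_assoc]
              congr 1
              push_cast
              module
          rw [key, List.length_ofFn]
          have h1 : ((serreLen A p q : ℕ) : ℂ) = 1 - A p q := by
            have := hA.offdiag p q hpq
            have h2 : ((serreLen A p q : ℕ) : ℤ) = 1 - A p q := by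
              rw [serreLen]
              omega
            exact_mod_cast congrArg (Int.cast : ℤ → ℂ) h2
          rw [h1]
          simp
        · by_cases hq : q = i
          · subst hq
            -- One bracket with `h_q` leaves a multiple of `x_p`, which the next `x_p` kills. A
            -- Serre relator of length one has `a_pq = 0`, hence `a_qp = 0`.
            have key : ∀ (ks : List ℤ) (k : ℤ), D ((k :: ks).foldr (fun s y => ⁅freeX p s, y⁆)
                (freeX q l)) = (if ks = [] then (A q p : ℂ) • gen A p (k + l) else 0, 0) := by
              intro ks
              induction ks with
              | nil =>
                intro k
                rw [List.foldr_cons, List.foldr_nil, hlie, if_pos rfl, if_neg hp, if_pos rfl]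
                simp
              | cons k' ks ih =>
                intro k
                rw [List.foldr_cons, hD', ih, extAct_apply, extAct_apply, hX, if_neg hp, ← gen_eq]
                rw [if_neg (List.cons_ne_nil _ _)]
                split_ifs <;> simp [isCurrentFamily_gen.lie_self, Prod.zero_eq_mk]
            rcases hks : List.ofFn k with _ | ⟨k', ks⟩
            · have := congrArg List.length hks
              have h2 := hA.offdiag p q hpq
              rw [List.length_ofFn, List.length_nil, serreLen] at this
              omega
            · rw [key]
              split_ifs with h
              · have := congrArg List.length hks
                have h2 := hA.offdiag p q hpq
                rw [List.length_ofFn, h, serreLen] at this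
                simp only [List.length_cons, List.length_nil] at this
                rw [hA.zero_symm p q (by omega)]
                simp
              · rfl
          · have key : ∀ ks : List ℤ, D (ks.foldr (fun s y => ⁅freeX p s, y⁆) (freeX q l)) = 0 := by
              intro ks
              induction ks with
              | nil => simp [hX, hq]
              | cons k ks ih =>
                rw [List.foldr_cons, hD', ih, hX, if_neg hp]
                simp [extAct_apply]
            exact key _)
  exact ⟨D, fun j l => hD (j, l), hD'⟩

end FPlus

/-- The pairing `⟨α, α_i^∨⟩ = ∑_j a_ij α_j`. -/
def corootPairing {n : ℕ} (A : Matrix (Fin n) (Fin n) ℤ) (i : Fin n) (α : Fin n → ℤ) : ℤ :=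
  ∑ j, A i j * α j

theorem corootPairing_add_smul {n : ℕ} {A : Matrix (Fin n) (Fin n) ℤ} (hA : IsGenCartan A)
    (i : Fin n) (α : Fin n → ℤ) (r : ℤ) :
    corootPairing A i (α + r • Pi.single i 1) = corootPairing A i α + 2 * r := by
  simp only [corootPairing, Pi.add_apply, Pi.smul_apply, mul_add, Finset.sum_add_distrib]
  congr 1
  rw [Finset.sum_eq_single i]
  · simp [hA.diag]
  · intro j _ hj
    simp [hj]
  · simp

namespace FPlus

variable {n : ℕ} {A : Matrix (Fin n) (Fin n) ℤ}

/-! ### The grading of `F̃₊` -/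

theorem gen_mem_part (i : Fin n) (k : ℤ) : gen A i k ∈ part A (Pi.single i 1) :=
  Submodule.subset_span (.gen i k)

theorem lie_mem_part {α β : Fin n → ℤ} {x y : FPlus A} (hx : x ∈ part A α) (hy : y ∈ part A β) :
    ⁅x, y⁆ ∈ part A (α + β) := by
  induction hx using Submodule.span_induction with
  | mem x hx =>
    induction hy using Submodule.span_induction with
    | mem y hy => exact Submodule.subset_span (.lie hx hy)
    | zero => simp
    | add y z _ _ hy hz => rw [lie_add]; exact Submodule.add_mem _ hy hz
    | smul c y _ hy => rw [lie_smul]; exact Submodule.smul_mem _ _ hy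
  | zero => simp
  | add x z _ _ hx hz => rw [add_lie]; exact Submodule.add_mem _ hx hz
  | smul c x _ hx => rw [smul_lie]; exact Submodule.smul_mem _ _ hx

instance gradedBracket_part (A : Matrix (Fin n) (Fin n) ℤ) : SetLike.GradedBracket (part A) where
  bracket_mem _ _ _ _ := lie_mem_part

theorem iSup_part (A : Matrix (Fin n) (Fin n) ℤ) : ⨆ α, part A α = ⊤ := by
  let K : LieSubalgebra ℂ (FPlus A) :=
    { ⨆ α, part A α with
      lie_mem' := by
        intro x y hx hy
        change x ∈ ⨆ α, part A α at hx
        change y ∈ ⨆ α, part A α at hy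
        change ⁅x, y⁆ ∈ ⨆ α, part A α
        induction hx using Submodule.iSup_induction' with
        | mem α x hx =>
          induction hy using Submodule.iSup_induction' with
          | mem β y hy => exact Submodule.mem_iSup_of_mem _ (lie_mem_part hx hy)
          | zero => simp
          | add y z _ _ hy hz => rw [lie_add]; exact Submodule.add_mem _ hy hz
        | zero => simp
        | add x z _ _ hx hz => rw [add_lie]; exact Submodule.add_mem _ hx hz }
  rw [eq_top_iff]
  exact fun u _ => mem_of_gen_mem K (fun i k => Submodule.mem_iSup_of_mem _ (gen_mem_part i k)) u

theorem deriv_zero_eq_smul (c : Fin n → ℂ) {α : Fin n → ℤ} {x : FPlus A} (hx : x ∈ part A α) :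
    deriv A c 0 x = (∑ j, c j * α j) • x := by
  induction hx using Submodule.span_induction with
  | mem x hx =>
    induction hx with
    | gen i k => simp [deriv_gen, Pi.single_apply]
    | @lie α β x y _ _ hx hy =>
      rw [deriv_lie, hx, hy, lie_smul, lie_smul, ← lie_skew y x, smul_neg, sub_neg_eq_add,
        ← add_smul, add_comm, ← Finset.sum_add_distrib]
      simp [mul_add]
  | zero => simp
  | add x y _ _ hx hy => rw [map_add, hx, hy, smul_add]
  | smul t x _ hx => rw [map_smul, hx, smul_comm]

theorem deriv_mem_part (c : Fin n → ℂ) (s : ℤ) {α : Fin n → ℤ} {x : FPlus A}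
    (hx : x ∈ part A α) : deriv A c s x ∈ part A α := by
  induction hx using Submodule.span_induction with
  | mem x hx =>
    induction hx with
    | gen i k =>
      rw [deriv_gen]
      exact Submodule.smul_mem _ _ (gen_mem_part _ _)
    | @lie α β x y hx' hy' hx hy =>
      rw [deriv_lie]
      refine Submodule.sub_mem _ (lie_mem_part (Submodule.subset_span hx') hy) ?_
      rw [add_comm]
      exact lie_mem_part (Submodule.subset_span hy') hx
  | zero => simp
  | add x y _ _ hx hy => rw [map_add]; exact Submodule.add_mem _ hx hy
  | smul t x _ hx => rw [map_smul]; exact Submodule.smul_mem _ _ hx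

theorem cartan_mem_part (i : Fin n) (c : ℤ →₀ ℂ) {α : Fin n → ℤ} {x : FPlus A}
    (hx : x ∈ part A α) : cartan A i c x ∈ part A α := by
  induction c using Finsupp.induction_linear with
  | zero => simp
  | add c d hc hd => rw [map_add]; exact Submodule.add_mem _ hc hd
  | single k t => rw [cartan_single]; exact Submodule.smul_mem _ _ (deriv_mem_part _ _ hx)

theorem IsMonomial.nonneg {α : Fin n → ℤ} {x : FPlus A} (hx : IsMonomial A α x) :
    0 ≤ α ∧ α ≠ 0 := by
  induction hx with
  | gen i k => exact ⟨Pi.single_nonneg.2 zero_le_one, by simp⟩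
  | @lie α β _ _ _ _ hx hy =>
    refine ⟨add_nonneg hx.1 hy.1, fun h => hx.2 ?_⟩
    exact le_antisymm (by rw [← h]; exact le_add_of_nonneg_right hy.1) hx.1

theorem part_eq_bot_of_not_nonneg {α : Fin n → ℤ} (h : ¬ (0 ≤ α ∧ α ≠ 0)) : part A α = ⊥ := by
  rw [part, Submodule.span_eq_bot]
  exact fun x hx => absurd hx.nonneg h

/-- A monomial whose degree is a multiple of `ε_i` is a generator, or zero. -/
theorem IsMonomial.eq_gen_or_eq_zero {α : Fin n → ℤ} {x : FPlus A} (hx : IsMonomial A α x)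
    (i : Fin n) (hα : ∀ j, j ≠ i → α j = 0) :
    x = 0 ∨ α = Pi.single i 1 ∧ ∃ k, x = FPlus.gen A i k := by
  induction hx with
  | gen j k =>
    by_cases h : j = i
    · subst h
      exact Or.inr ⟨rfl, k, rfl⟩
    · have := hα j h
      simp at this
  | @lie α β x y hx' hy' hx hy =>
    have hαβ : ∀ j, j ≠ i → α j = 0 ∧ β j = 0 := by
      intro j hj
      have h1 := hx'.nonneg.1 j
      have h2 := hy'.nonneg.1 j
      have h3 := hα j hj
      simp only [Pi.add_apply, Pi.zero_apply] at h1 h2 h3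
      omega
    left
    rcases hx fun j hj => (hαβ j hj).1 with rfl | ⟨-, k, rfl⟩
    · simp
    rcases hy fun j hj => (hαβ j hj).2 with rfl | ⟨-, l, rfl⟩
    · simp
    exact isCurrentFamily_gen.lie_self i k l

theorem part_eq_bot_of_support {α : Fin n → ℤ} (i : Fin n) (hα : ∀ j, j ≠ i → α j = 0)
    (h : α ≠ Pi.single i 1) : part A α = ⊥ := by
  rw [part, Submodule.span_eq_bot]
  exact fun x hx => (hx.eq_gen_or_eq_zero i hα).resolve_right fun h' => h h'.1

theorem part_single_le (i : Fin n) :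
    part A (Pi.single i 1) ≤ Submodule.span ℂ (Set.range (gen A i)) := by
  refine Submodule.span_le.2 fun x hx => ?_
  rcases hx.eq_gen_or_eq_zero i fun j hj => by simp [hj] with rfl | ⟨-, k, rfl⟩
  · exact Submodule.zero_mem _
  · exact Submodule.subset_span ⟨k, rfl⟩

/-- By the Jacobi identity `ad` of a monomial is a combination of products of `ad`'s of generators.
The last generator to act starts from a component of degree `α - ε_i`, which is zero. -/
theorem lie_eq_zero_of_forall_part_sub_eq_bot {α β γ : Fin n → ℤ}
    (h : ∀ i, part A (α - Pi.single i 1) = ⊥) {x y : FPlus A} (hx : IsMonomial A β x)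
    (hy : y ∈ part A γ) (hα : β + γ = α) : ⁅x, y⁆ = 0 := by
  induction hx generalizing y γ with
  | gen i k =>
    have : γ = α - Pi.single i 1 := by rw [← hα, add_sub_cancel_left]
    rw [this, h, Submodule.mem_bot] at hy
    rw [hy, lie_zero]
  | @lie β β' x z hx' hz' hx hz =>
    rw [lie_lie, hx (lie_mem_part (Submodule.subset_span hz') hy) (by rw [← hα, add_assoc]),
      hz (lie_mem_part (Submodule.subset_span hx') hy) (by rw [← hα]; abel), sub_zero]

/-- A nonzero component that does not consist of generators has a nonzero predecessor. -/
theorem exists_part_sub_ne_bot {α : Fin n → ℤ} (hα : part A α ≠ ⊥)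
    (hα' : ∀ i, α ≠ Pi.single i 1) : ∃ i, part A (α - Pi.single i 1) ≠ ⊥ := by
  by_contra! h
  refine hα ?_
  rw [part, Submodule.span_eq_bot]
  intro x hx
  cases hx with
  | gen i k => exact absurd rfl (hα' i)
  | lie hx hy => exact lie_eq_zero_of_forall_part_sub_eq_bot h hx (Submodule.subset_span hy) rfl

/-! ### Raising and lowering operators -/

/-- The vectors killed by a power of `ad x_i[0]` form the Engel subalgebra, and the Serre relations
put the generators in it. -/
theorem exists_ad_pow_eq_zero (i : Fin n) (x : FPlus A) :
    ∃ m, (LieAlgebra.ad ℂ (FPlus A) (gen A i 0) ^ m) x = 0 := by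
  rw [← LieSubalgebra.mem_engel_iff]
  refine mem_of_gen_mem _ (fun j k => ?_) x
  rw [LieSubalgebra.mem_engel_iff]
  by_cases h : i = j
  · subst h
    exact ⟨1, by simpa using isCurrentFamily_gen.lie_self i 0 k⟩
  · exact ⟨_, ad_pow_gen h k⟩

/-- The cocycle `x ↦ [f_i[0], x]` with values in `F̃₊` extended by the `h_i[k]`. -/
def lower (hA : IsGenCartan A) (i : Fin n) : FPlus A →ₗ[ℂ] FPlus A × (ℤ →₀ ℂ) :=
  (exists_lower hA i).choose

theorem lower_gen (hA : IsGenCartan A) (i j : Fin n) (l : ℤ) :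
    lower hA i (gen A j l) = (0, if j = i then Finsupp.single l (-1) else 0) :=
  (exists_lower hA i).choose_spec.1 j l

theorem lower_lie (hA : IsGenCartan A) (i : Fin n) (u v : FPlus A) :
    lower hA i ⁅u, v⁆ = (⁅u, (lower hA i v).1⁆ - cartan A i (lower hA i v).2 u -
      (⁅v, (lower hA i u).1⁆ - cartan A i (lower hA i u).2 v), 0) := by
  rw [lower, (exists_lower hA i).choose_spec.2, extAct_apply, extAct_apply]
  simp

theorem IsMonomial.lower_mem (hA : IsGenCartan A) (i : Fin n) {α : Fin n → ℤ} {x : FPlus A}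
    (hx : IsMonomial A α x) : (lower hA i x).1 ∈ part A (α - Pi.single i 1) ∧
      (α ≠ Pi.single i 1 → (lower hA i x).2 = 0) := by
  induction hx with
  | gen j k =>
    rw [lower_gen]
    refine ⟨Submodule.zero_mem _, fun h => if_neg ?_⟩
    rintro rfl
    exact h rfl
  | @lie α β x y hx' hy' hx hy =>
    have key : ∀ {α β : Fin n → ℤ} {x y : FPlus A}, IsMonomial A α x → 
        (lower hA i y).1 ∈ part A (β - Pi.single i 1) →
        (β ≠ Pi.single i 1 → (lower hA i y).2 = 0) → 
        ⁅x, (lower hA i y).1⁆ - cartan A i (lower hA i y).2 x ∈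
          part A (α + β - Pi.single i 1) := by
      intro α β x y hx hy hy'
      refine Submodule.sub_mem _ ?_ ?_
      · rw [add_sub_assoc]
        exact lie_mem_part (Submodule.subset_span hx) hy
      -- An `h_i[k]` component is present only in degree `β = ε_i`; it preserves the degree of `x`,
      -- which is then `α + β - ε_i`.
      · by_cases hβ : β = Pi.single i 1
        · rw [hβ, add_sub_cancel_right]
          exact cartan_mem_part _ _ (Submodule.subset_span hx)
        · simp [hy' hβ]
    rw [lower_lie]
    refine ⟨Submodule.sub_mem _ (key hx' hy.1 hy.2) ?_, fun _ => rfl⟩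
    rw [add_comm α]
    exact key hy' hx.1 hx.2

theorem lower_fst_mem_part (hA : IsGenCartan A) (i : Fin n) {α : Fin n → ℤ} {x : FPlus A}
    (hx : x ∈ part A α) : (lower hA i x).1 ∈ part A (α - Pi.single i 1) := by
  induction hx using Submodule.span_induction with
  | mem x hx => exact (hx.lower_mem hA i).1
  | zero => simp
  | add x y _ _ hx hy => rw [map_add]; exact Submodule.add_mem _ hx hy
  | smul t x _ hx => rw [map_smul]; exact Submodule.smul_mem _ _ hx

theorem lower_snd_eq_zero (hA : IsGenCartan A) (i : Fin n) {α : Fin n → ℤ} {x : FPlus A}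
    (hx : x ∈ part A α) (hα : α ≠ Pi.single i 1) : (lower hA i x).2 = 0 := by
  induction hx using Submodule.span_induction with
  | mem x hx => exact (hx.lower_mem hA i).2 hα
  | zero => simp
  | add x y _ _ hx hy => rw [map_add, Prod.snd_add, hx, hy, add_zero]
  | smul t x _ hx => rw [map_smul, Prod.smul_snd, hx, smul_zero]

/-- The lowering operator: bracket with `f_i[0]`, except in degree `ε_i`. -/
def lowerEnd (hA : IsGenCartan A) (i : Fin n) : Module.End ℂ (FPlus A) :=
  LinearMap.fst ℂ _ _ ∘ₗ lower hA i

/-- This is `[e_i, f_i] = h_i`. In degree `ε_i` the bracket with `f_i[0]` leaves F̃₊, so that degree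
is excluded. -/
theorem ad_lowerEnd_sub (hA : IsGenCartan A) (i : Fin n) {α : Fin n → ℤ} {x : FPlus A}
    (hx : x ∈ part A α) (hα : α ≠ Pi.single i 1) :
    ⁅gen A i 0, lowerEnd hA i x⁆ - lowerEnd hA i ⁅gen A i 0, x⁆ =
      (corootPairing A i α : ℂ) • x := by
  have : (corootPairing A i α : ℂ) • x = deriv A (fun j => (A i j : ℂ)) 0 x := by
    rw [deriv_zero_eq_smul _ hx, corootPairing]
    push_cast
    rfl
  rw [this]
  change ⁅gen A i 0, (lower hA i x).1⁆ - (lower hA i ⁅gen A i 0, x⁆).1 = _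
  rw [lower_lie, lower_gen, lower_snd_eq_zero hA i hx hα, if_pos rfl, cartan_single]
  simp

/-- A nonzero coordinate at some `j ≠ i` is constant along the string and keeps it away from degree
`ε_i`. -/
theorem isSl2String (hA : IsGenCartan A) (i : Fin n) (α : Fin n → ℤ) (hα : ∃ j, j ≠ i ∧ α j ≠ 0) :
    IsSl2String (fun r => part A (α + r • Pi.single i 1)) (LieAlgebra.ad ℂ (FPlus A) (gen A i 0))
      (lowerEnd hA i) (corootPairing A i α) where
  mapE r x hx := by
    have := lie_mem_part (gen_mem_part i 0) hx
    rwa [add_comm, add_assoc, ← add_one_zsmul] at this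
  mapF r x hx := by
    have := lower_fst_mem_part hA i hx
    rw [add_sub_assoc] at this
    rwa [sub_smul, one_smul]
  comm r x hx := by
    rw [LieAlgebra.ad_apply, LieAlgebra.ad_apply, ad_lowerEnd_sub hA i hx,
      corootPairing_add_smul hA]
    intro h
    obtain ⟨j, hj, hj'⟩ := hα
    have := congrFun h j
    simp [hj] at this
    exact hj' this

theorem exists_lowerEnd_pow_eq_zero (hA : IsGenCartan A) (i : Fin n) {α : Fin n → ℤ}
    {x : FPlus A} (hx : x ∈ part A α) : ∃ m, (lowerEnd hA i ^ m) x = 0 := by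
  have h : ∀ m : ℕ, (lowerEnd hA i ^ m) x ∈ part A (α - (m : ℤ) • Pi.single i 1) := by
    intro m
    induction m with
    | zero => simpa using hx
    | succ m ih =>
      rw [pow_succ', Module.End.mul_apply]
      have := lower_fst_mem_part hA i ih
      rwa [sub_sub, ← add_one_zsmul] at this
  -- After this many lowerings the `i`-th coordinate of the degree is negative.
  refine ⟨(α i).toNat + 1, ?_⟩
  have h' := h ((α i).toNat + 1)
  rw [part_eq_bot_of_not_nonneg, Submodule.mem_bot] at h'
  · exact h'
  · rintro ⟨h1, -⟩
    have := h1 i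
    simp at this

end FPlus

/-! ### Chevalley relations -/

section Chevalley

variable {n : ℕ} {L : Type*} [LieRing L] [LieAlgebra ℂ L]

/-- The relations among the `e_i`, `f_i`, `h_i`, without the Serre relations. -/
structure IsChevalleyFamily (A : Matrix (Fin n) (Fin n) ℤ) (e f h : Fin n → L) : Prop where
  he : ∀ i j, ⁅h i, e j⁆ = (A i j : ℂ) • e j
  hf : ∀ i j, ⁅h i, f j⁆ = -((A i j : ℂ) • f j)
  ef : ∀ i j, ⁅e i, f j⁆ = if i = j then h i else 0

namespace IsChevalleyFamily

variable {A : Matrix (Fin n) (Fin n) ℤ} {e f h : Fin n → L}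

theorem symm (H : IsChevalleyFamily A e f h) : IsChevalleyFamily A f e (-h) where
  he i j := by rw [Pi.neg_apply, neg_lie, H.hf, neg_neg]
  hf i j := by rw [Pi.neg_apply, neg_lie, H.he]
  ef i j := by
    rw [← lie_skew, H.ef]
    by_cases hij : i = j
    · subst hij
      simp
    · simp [hij, Ne.symm hij]

theorem h_lie_ad_pow (H : IsChevalleyFamily A e f h) (k i j : Fin n) (r : ℕ) :
    ⁅h k, (LieAlgebra.ad ℂ L (e i) ^ r) (e j)⁆ =
      (A k j + r * A k i : ℂ) • (LieAlgebra.ad ℂ L (e i) ^ r) (e j) := by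
  induction r with
  | zero => simp [H.he]
  | succ r ih =>
    rw [pow_succ', Module.End.mul_apply, LieAlgebra.ad_apply, leibniz_lie, ih, H.he, lie_smul,
      smul_lie]
    push_cast
    module

theorem f_lie_ad_pow (H : IsChevalleyFamily A e f h) (hA : IsGenCartan A) {i j : Fin n}
    (hij : i ≠ j) (r : ℕ) :
    ⁅f i, (LieAlgebra.ad ℂ L (e i) ^ r) (e j)⁆ =
      (-(r * (A i j + r - 1)) : ℂ) • (LieAlgebra.ad ℂ L (e i) ^ (r - 1)) (e j) := by
  have hfe : ∀ k l, ⁅f k, e l⁆ = if l = k then -h l else 0 := by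
    intro k l
    rw [← lie_skew, H.ef]
    split_ifs <;> simp
  induction r with
  | zero => simp [hfe, hij.symm]
  | succ r ih =>
    rw [pow_succ', Module.End.mul_apply, LieAlgebra.ad_apply, leibniz_lie, ih, hfe, if_pos rfl,
      neg_lie, H.h_lie_ad_pow, lie_smul, hA.diag]
    have h2 : (r : ℂ) • ⁅e i, (LieAlgebra.ad ℂ L (e i) ^ (r - 1)) (e j)⁆ =
        (r : ℂ) • (LieAlgebra.ad ℂ L (e i) ^ r) (e j) := by
      rcases r with _ | r
      · simp
      · rw [Nat.add_sub_cancel, pow_succ', Module.End.mul_apply, LieAlgebra.ad_apply]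
    have h3 := congrArg (fun y => (-(A i j + r - 1 : ℂ)) • y) h2
    simp only [smul_smul] at h3
    rw [show -((r : ℂ) * (A i j + r - 1)) = -(A i j + r - 1 : ℂ) * r by ring, h3,
      Nat.add_sub_cancel]
    push_cast
    module

/-- For `k = i` this is the vanishing of the coefficient in `f_lie_ad_pow` at `r = 1 - a_ij`. For `k
= j` the operator `ad e_i` sends `h_j` to a multiple of `e_i` and then to `0`; if it occurs only
once, then `a_ij = 0 = a_ji`. Other `f_k` commute with everything involved. -/
theorem f_lie_serre (H : IsChevalleyFamily A e f h) (hA : IsGenCartan A) {i j : Fin n}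
    (hij : i ≠ j) (k : Fin n) :
    ⁅f k, (LieAlgebra.ad ℂ L (e i) ^ serreLen A i j) (e j)⁆ = 0 := by
  have hm : ((serreLen A i j : ℕ) : ℤ) = 1 - A i j := by
    have := hA.offdiag i j hij
    rw [serreLen]
    omega
  by_cases hk : k = i
  · subst hk
    rw [H.f_lie_ad_pow hA hij]
    have h1 : ((serreLen A k j : ℕ) : ℂ) = 1 - A k j := by
      exact_mod_cast congrArg (Int.cast : ℤ → ℂ) hm
    rw [h1]
    simp
  · have hc : ∀ r, ⁅f k, (LieAlgebra.ad ℂ L (e i) ^ r) (e j)⁆ =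
        (LieAlgebra.ad ℂ L (e i) ^ r) ⁅f k, e j⁆ := by
      intro r
      induction r with
      | zero => rfl
      | succ r ih =>
        rw [pow_succ', Module.End.mul_apply, Module.End.mul_apply, LieAlgebra.ad_apply,
          LieAlgebra.ad_apply, leibniz_lie, ih, ← lie_skew (f k) (e i), H.ef, if_neg (Ne.symm hk)]
        simp
    have h1 : ∀ r, (LieAlgebra.ad ℂ L (e i) ^ (r + 1)) (h j) =
        if r = 0 then -((A j i : ℂ) • e i) else 0 := by
      intro r
      induction r with
      | zero => rw [← H.he, lie_skew]; simp
      | succ r ih =>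
        rw [pow_succ', Module.End.mul_apply, ih]
        split_ifs <;> simp_all
    rw [hc, ← lie_skew, H.ef, map_neg]
    split_ifs with hjk
    · obtain ⟨r, hr⟩ : ∃ r, serreLen A i j = r + 1 := by
        have := hA.offdiag i j hij
        exact ⟨serreLen A i j - 1, by omega⟩
      rw [hr, h1]
      split_ifs with hr0
      · rw [hA.zero_symm i j (by omega)]
        simp
      · simp
    · simp

end IsChevalleyFamily

end Chevalley

/-! ### A highest weight module -/

namespace Verma

variable {n : ℕ} {M : Type*} [AddCommGroup M] [Module ℂ M]
  (A : Matrix (Fin n) (Fin n) ℤ) (b : Module.Basis (List (Fin n)) ℂ M)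

/-- The operator `f_i` on the module `M` freely generated by the `f_i`, with its basis of words in
the `f_i` applied to the vacuum vector `b []`. -/
def F (i : Fin n) : Module.End ℂ M := b.constr ℂ fun w => b (i :: w)

/-- The diagonal operator with eigenvalue `c₀ - ∑_{j ∈ w} c j` on the word `w`. -/
def diag (c₀ : ℂ) (c : Fin n → ℂ) : Module.End ℂ M :=
  b.constr ℂ fun w => (c₀ - (w.map c).sum) • b w

/-- The operator `h_i`; it has eigenvalue `1` on the vacuum. -/
def H (i : Fin n) : Module.End ℂ M := diag b 1 fun j => (A i j : ℂ)

/-- The image of a word under `e_i`. -/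
def raise (i : Fin n) : List (Fin n) → M
  | [] => 0
  | j :: w => F b j (raise i w) + if i = j then H A b i (b w) else 0

/-- The operator `e_i`. -/
def E (i : Fin n) : Module.End ℂ M := b.constr ℂ (raise A b i)

theorem F_basis (i : Fin n) (w : List (Fin n)) : F b i (b w) = b (i :: w) := b.constr_basis ℂ _ w

theorem diag_basis (c₀ : ℂ) (c : Fin n → ℂ) (w : List (Fin n)) :
    diag b c₀ c (b w) = (c₀ - (w.map c).sum) • b w := b.constr_basis ℂ _ w

theorem E_basis (i : Fin n) (w : List (Fin n)) : E A b i (b w) = raise A b i w :=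
  b.constr_basis ℂ _ w

theorem E_vac (i : Fin n) : E A b i (b []) = 0 := by rw [E_basis, raise]

theorem lie_apply (X Y : Module.End ℂ M) (u : M) : ⁅X, Y⁆ u = X (Y u) - Y (X u) := rfl

/-- An operator that kills the vacuum and commutes with the `f_i` is zero. -/
theorem eq_zero_of_lie_F {X : Module.End ℂ M} (h : ∀ k, ⁅X, F b k⁆ = 0) (h0 : X (b []) = 0) :
    X = 0 := by
  refine b.ext fun w => ?_
  rw [LinearMap.zero_apply]
  induction w with
  | nil => exact h0
  | cons k w ih =>
    have := LinearMap.congr_fun (h k) (b w)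
    rw [lie_apply, ih, F_basis] at this
    simpa using this

theorem diag_lie_diag (c₀ d₀ : ℂ) (c d : Fin n → ℂ) : ⁅diag b c₀ c, diag b d₀ d⁆ = 0 := by
  refine b.ext fun w => ?_
  rw [lie_apply, diag_basis, diag_basis, map_smul, map_smul, diag_basis, diag_basis,
    smul_comm, sub_self, LinearMap.zero_apply]

theorem diag_lie_F (c₀ : ℂ) (c : Fin n → ℂ) (j : Fin n) :
    ⁅diag b c₀ c, F b j⁆ = -(c j • F b j) := by
  refine b.ext fun w => ?_
  rw [lie_apply, diag_basis, map_smul, F_basis, diag_basis, List.map_cons,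
    List.sum_cons, LinearMap.neg_apply, LinearMap.smul_apply, F_basis]
  module

theorem E_lie_F (i j : Fin n) : ⁅E A b i, F b j⁆ = if i = j then H A b i else 0 := by
  refine b.ext fun w => ?_
  rw [lie_apply, F_basis, E_basis, E_basis, raise]
  split_ifs <;> simp

/-- Both sides kill the vacuum and, by the Jacobi identity, have the same brackets with every `F b
k`. -/
theorem diag_lie_E (c₀ : ℂ) (c : Fin n → ℂ) (j : Fin n) :
    ⁅diag b c₀ c, E A b j⁆ = c j • E A b j := by
  rw [← sub_eq_zero]
  refine eq_zero_of_lie_F b (fun k => ?_) ?_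
  · rw [sub_lie, lie_lie, E_lie_F, diag_lie_F, smul_lie, E_lie_F, lie_neg, lie_smul, E_lie_F]
    by_cases h : j = k
    · subst h
      rw [if_pos rfl, H, diag_lie_diag]
      simp
    · simp [h]
  · rw [LinearMap.sub_apply, lie_apply, diag_basis, map_smul, LinearMap.smul_apply, E_vac]
    simp

theorem isChevalleyFamily : IsChevalleyFamily A (E A b) (F b) (H A b) where
  he _ _ := diag_lie_E A b _ _ _
  hf _ _ := diag_lie_F b _ _ _
  ef i j := E_lie_F A b i j

/-- The functionals "coefficient of the vacuum in `e_{i_m} ⋯ e_{i_1} u`". -/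
def raiseCoeff : List (Fin n) → M →ₗ[ℂ] ℂ
  | [] => b.coord []
  | i :: l => raiseCoeff l ∘ₗ E A b i

/-- The vectors that cannot be raised to the vacuum: the largest proper submodule. -/
def radical : Submodule ℂ M := ⨅ l, LinearMap.ker (raiseCoeff A b l)

variable {A b}

theorem mem_radical {u : M} : u ∈ radical A b ↔ ∀ l, raiseCoeff A b l u = 0 := by
  simp [radical]

theorem E_mem_radical (i : Fin n) {u : M} (hu : u ∈ radical A b) : E A b i u ∈ radical A b :=
  mem_radical.2 fun l => mem_radical.1 hu (i :: l)

theorem lie_apply_eq {X Y Z : Module.End ℂ M} (h : ⁅X, Y⁆ = Z) (u : M) :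
    X (Y u) = Y (X u) + Z u := by
  rw [← h, lie_apply]
  abel

theorem coord_nil_diag (c₀ : ℂ) (c : Fin n → ℂ) (u : M) :
    b.coord [] (diag b c₀ c u) = c₀ * b.coord [] u := by
  have : b.coord [] ∘ₗ diag b c₀ c = c₀ • b.coord [] := by
    refine b.ext fun w => ?_
    simp only [LinearMap.comp_apply, LinearMap.smul_apply, diag_basis]
    rcases w with _ | ⟨j, w⟩ <;> simp
  exact LinearMap.congr_fun this u

theorem coord_nil_F (i : Fin n) (u : M) : b.coord [] (F b i u) = 0 := by
  have : b.coord [] ∘ₗ F b i = 0 := by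
    refine b.ext fun w => ?_
    simp only [LinearMap.comp_apply, F_basis]
    simp
  exact LinearMap.congr_fun this u

theorem diag_mem_radical (c₀ : ℂ) (c : Fin n → ℂ) {u : M} (hu : u ∈ radical A b) :
    diag b c₀ c u ∈ radical A b := by
  refine mem_radical.2 fun l => ?_
  induction l generalizing u with
  | nil =>
    change b.coord [] _ = 0
    rw [coord_nil_diag, show b.coord [] u = 0 from mem_radical.1 hu [], mul_zero]
  | cons i l ih =>
    have h := lie_apply_eq (diag_lie_E A b c₀ c i) u
    rw [← sub_eq_iff_eq_add] at h
    change raiseCoeff A b l (E A b i _) = 0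
    rw [← h, map_sub, ih (E_mem_radical i hu), LinearMap.smul_apply, map_smul,
      mem_radical.1 (E_mem_radical i hu), smul_zero, sub_zero]

theorem F_mem_radical (k : Fin n) {u : M} (hu : u ∈ radical A b) : F b k u ∈ radical A b := by
  refine mem_radical.2 fun l => ?_
  induction l generalizing u with
  | nil => exact coord_nil_F k u
  | cons i l ih =>
    change raiseCoeff A b l (E A b i _) = 0
    rw [lie_apply_eq (E_lie_F A b i k), map_add, ih (E_mem_radical i hu), zero_add]
    split_ifs
    · exact mem_radical.1 (diag_mem_radical _ _ hu) l
    · simp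

/-- By `f_lie_serre` this element commutes with all `F b k`, and it kills the vacuum. -/
theorem serreE_eq_zero (hA : IsGenCartan A) {i j : Fin n} (hij : i ≠ j) :
    (LieAlgebra.ad ℂ (Module.End ℂ M) (E A b i) ^ serreLen A i j) (E A b j) = 0 := by
  refine eq_zero_of_lie_F b (fun k => ?_) ?_
  · rw [← lie_skew, (isChevalleyFamily A b).f_lie_serre hA hij, neg_zero]
  · generalize serreLen A i j = r
    induction r with
    | zero => exact E_vac A b j
    | succ r ih =>
      rw [pow_succ', Module.End.mul_apply, LieAlgebra.ad_apply, lie_apply, ih, E_vac]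
      simp

/-- Unlike the relations in the `E`'s, this one need not hold on `M`. But the element commutes with
every `E A b k`, so raising operators pass to its right, and its image has no vacuum component. -/
theorem serreF_mem_radical (hA : IsGenCartan A) {i j : Fin n} (hij : i ≠ j) (u : M) :
    (LieAlgebra.ad ℂ (Module.End ℂ M) (F b i) ^ serreLen A i j) (F b j) u ∈ radical A b := by
  refine mem_radical.2 fun l => ?_
  induction l generalizing u with
  | nil =>
    change b.coord [] _ = 0
    generalize serreLen A i j = r
    induction r generalizing u with
    | zero => exact coord_nil_F j u
    | succ r ih =>
      rw [pow_succ', Module.End.mul_apply, LieAlgebra.ad_apply, lie_apply, map_sub, ih,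
        coord_nil_F, sub_zero]
  | cons k l ih =>
    change raiseCoeff A b l (E A b k _) = 0
    rw [lie_apply_eq ((isChevalleyFamily A b).symm.f_lie_serre hA hij k), map_add, ih]
    simp

end Verma

/-! ### The Kac-Moody algebra -/

namespace KacMoody

variable {n : ℕ} {A : Matrix (Fin n) (Fin n) ℤ} {S : Finset (Fin n)}

/-- The ideal of relations of the Kac-Moody algebra. -/
abbrev relIdeal (A : Matrix (Fin n) (Fin n) ℤ) (S : Finset (Fin n)) :
    LieIdeal ℂ (FreeLieAlgebra ℂ (KMGen S)) :=
  LieSubmodule.lieSpan ℂ (FreeLieAlgebra ℂ (KMGen S)) {x | KMRel A S x}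

theorem gen_eq (g : KMGen S) : gen A S g = (relIdeal A S).mkHom (FreeLieAlgebra.of ℂ g) := rfl

theorem mkHom_eq_zero {x : FreeLieAlgebra ℂ (KMGen S)} (hx : KMRel A S x) :
    (relIdeal A S).mkHom x = 0 :=
  LieIdeal.mkHom_eq_zero (I := relIdeal A S) (LieSubmodule.subset_lieSpan hx)

/-- The action of the generators on the highest weight module. -/
def vermaGen {M : Type*} [AddCommGroup M] [Module ℂ M] (A : Matrix (Fin n) (Fin n) ℤ)
    (b : Module.Basis (List (Fin n)) ℂ M) : KMGen S → Module.End ℂ M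
  | .h i => Verma.H A b i
  | .D j => Verma.diag b 0 fun i => if i = j.1 then 1 else 0
  | .e i => Verma.E A b i
  | .f i => Verma.F b i

/-- In effect 𝔤 acts on `M` modulo its radical, where `h_i` fixes the nonzero class of the vacuum.
Instead of forming the quotient, the proof uses the ideal `N` of elements that map `M` into the
radical; it is an ideal because the whole free Lie algebra preserves the radical (`hK`). -/
theorem gen_h_ne_zero_of_basis {M : Type*} [AddCommGroup M] [Module ℂ M]
    (b : Module.Basis (List (Fin n)) ℂ M) (hA : IsGenCartan A) (i : Fin n) :
    gen A S (.h i) ≠ 0 := by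
  let ρ : FreeLieAlgebra ℂ (KMGen S) →ₗ⁅ℂ⁆ Module.End ℂ M :=
    FreeLieAlgebra.lift ℂ (vermaGen A b)
  have hρ : ∀ g, ρ (FreeLieAlgebra.of ℂ g) = vermaGen A b g := fun g =>
    FreeLieAlgebra.lift_of_apply _ g
  let K : LieSubalgebra ℂ (FreeLieAlgebra ℂ (KMGen S)) :=
    { carrier := {x | ∀ u ∈ Verma.radical A b, ρ x u ∈ Verma.radical A b}
      add_mem' := fun {x y} hx hy u hu => by
        rw [map_add]
        exact Submodule.add_mem _ (hx u hu) (hy u hu)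
      zero_mem' := fun u _ => by
        rw [map_zero]
        exact Submodule.zero_mem _
      smul_mem' := fun c x hx u hu => by
        rw [map_smul]
        exact Submodule.smul_mem _ c (hx u hu)
      lie_mem' := fun {x y} hx hy u hu => by
        rw [LieHom.map_lie, LieRing.of_associative_ring_bracket]
        exact Submodule.sub_mem _ (hx _ (hy u hu)) (hy _ (hx u hu)) }
  have hK : ∀ x, ∀ u ∈ Verma.radical A b, ρ x u ∈ Verma.radical A b := fun x => by
    refine FreeLieAlgebra.mem_of_forall_of_mem K (fun g u hu => ?_) x
    rw [hρ]
    cases g with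
    | h i => exact Verma.diag_mem_radical _ _ hu
    | D j => exact Verma.diag_mem_radical _ _ hu
    | e i => exact Verma.E_mem_radical i hu
    | f i => exact Verma.F_mem_radical i hu
  let N : LieIdeal ℂ (FreeLieAlgebra ℂ (KMGen S)) :=
    { carrier := {x | ∀ u, ρ x u ∈ Verma.radical A b}
      add_mem' := fun {x y} hx hy u => by
        rw [map_add]
        exact Submodule.add_mem _ (hx u) (hy u)
      zero_mem' := fun u => by
        rw [map_zero]
        exact Submodule.zero_mem _
      smul_mem' := fun c x hx u => by
        rw [map_smul]
        exact Submodule.smul_mem _ c (hx u)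
      lie_mem := fun {x y} hy u => by
        rw [LieHom.map_lie, LieRing.of_associative_ring_bracket]
        exact Submodule.sub_mem _ (hK x _ (hy u)) (hy _) }
  have hle : relIdeal A S ≤ N := by
    refine LieSubmodule.lieSpan_le.2 fun x hx u => ?_
    have h0 : ρ x = 0 → ρ x u ∈ Verma.radical A b := fun h => by
      rw [h]
      exact Submodule.zero_mem _
    have hV := Verma.isChevalleyFamily A b
    cases hx with
    | hh i j => exact h0 (by simpa [KMGen.freeH, hρ, vermaGen, Verma.H] using Verma.diag_lie_diag b _ _ _ _)
    | hD i j =>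
      exact h0 (by
        simpa [KMGen.freeH, KMGen.freeD, hρ, vermaGen, Verma.H] using Verma.diag_lie_diag b _ _ _ _)
    | DD i j => exact h0 (by simpa [KMGen.freeD, hρ, vermaGen] using Verma.diag_lie_diag b _ _ _ _)
    | he i j => exact h0 (by simp [KMGen.freeH, KMGen.freeE, hρ, vermaGen, hV.he])
    | hf i j => exact h0 (by simp [KMGen.freeH, KMGen.freeF, hρ, vermaGen, hV.hf])
    | De j i =>
      refine h0 ?_
      rw [map_sub, map_smul, LieHom.map_lie, KMGen.freeD, KMGen.freeE, hρ, hρ]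
      exact sub_eq_zero.2 (Verma.diag_lie_E A b _ _ _)
    | Df j i =>
      refine h0 ?_
      rw [map_add, map_smul, LieHom.map_lie, KMGen.freeD, KMGen.freeF, hρ, hρ]
      exact add_eq_zero_iff_eq_neg.2 (Verma.diag_lie_F b _ _ _)
    | ef i j =>
      refine h0 ?_
      simp only [KMGen.freeE, KMGen.freeF, KMGen.freeH, hρ, vermaGen, map_sub, map_smul,
        LieHom.map_lie, hV.ef]
      split_ifs <;> simp
    | serreE i j hij =>
      refine h0 ?_
      rw [LieHom.map_ad_pow, KMGen.freeE, KMGen.freeE, hρ, hρ]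
      exact Verma.serreE_eq_zero hA hij
    | serreF i j hij =>
      rw [LieHom.map_ad_pow, KMGen.freeF, KMGen.freeF, hρ, hρ]
      exact Verma.serreF_mem_radical hA hij u
  intro h
  have hmem : FreeLieAlgebra.of ℂ (KMGen.h i) ∈ relIdeal A S :=
    (LieSubmodule.Quotient.mk_eq_zero (N := relIdeal A S)).1 h
  have h1 := Verma.mem_radical.1 (hle hmem (b [])) []
  rw [hρ] at h1
  change b.coord [] (Verma.diag b _ _ _) = 0 at h1
  rw [Verma.coord_nil_diag] at h1
  simp at h1

theorem gen_h_ne_zero (hA : IsGenCartan A) (i : Fin n) : gen A S (.h i) ≠ 0 :=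
  gen_h_ne_zero_of_basis Finsupp.basisSingleOne hA i

theorem h_lie_e (i j : Fin n) : ⁅gen A S (.h i), gen A S (.e j)⁆ = (A i j : ℂ) • gen A S (.e j) := by
  rw [← sub_eq_zero]
  exact mkHom_eq_zero (.he i j)

theorem h_lie_f (i j : Fin n) :
    ⁅gen A S (.h i), gen A S (.f j)⁆ = -((A i j : ℂ) • gen A S (.f j)) := by
  rw [← add_eq_zero_iff_eq_neg]
  exact mkHom_eq_zero (.hf i j)

theorem D_lie_e (j : {j // j ∈ S}) (i : Fin n) :
    ⁅gen A S (.D j), gen A S (.e i)⁆ = (if i = j.1 then (1 : ℂ) else 0) • gen A S (.e i) := by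
  rw [← sub_eq_zero]
  exact mkHom_eq_zero (.De j i)

theorem D_lie_f (j : {j // j ∈ S}) (i : Fin n) :
    ⁅gen A S (.D j), gen A S (.f i)⁆ = -((if i = j.1 then (1 : ℂ) else 0) • gen A S (.f i)) := by
  rw [← add_eq_zero_iff_eq_neg]
  exact mkHom_eq_zero (.Df j i)

theorem e_lie_f (i j : Fin n) :
    ⁅gen A S (.e i), gen A S (.f j)⁆ = if i = j then gen A S (.h i) else 0 := by
  have : ⁅gen A S (.e i), gen A S (.f j)⁆ = (if i = j then (1 : ℂ) else 0) • gen A S (.h i) := by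
    rw [← sub_eq_zero]
    exact mkHom_eq_zero (.ef i j)
  rw [this]
  split_ifs <;> simp

theorem serre_e {i j : Fin n} (hij : i ≠ j) :
    (LieAlgebra.ad ℂ (KacMoody A S) (gen A S (.e i)) ^ serreLen A i j) (gen A S (.e j)) = 0 := by
  have := mkHom_eq_zero (.serreE (A := A) (S := S) i j hij)
  rwa [LieHom.map_ad_pow] at this

theorem serre_f {i j : Fin n} (hij : i ≠ j) :
    (LieAlgebra.ad ℂ (KacMoody A S) (gen A S (.f i)) ^ serreLen A i j) (gen A S (.f j)) = 0 := by
  have := mkHom_eq_zero (.serreF (A := A) (S := S) i j hij)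
  rwa [LieHom.map_ad_pow] at this

theorem gen_e_ne_zero (hA : IsGenCartan A) (i : Fin n) : gen A S (.e i) ≠ 0 := by
  intro h
  have := e_lie_f (A := A) (S := S) i i
  rw [h, zero_lie, if_pos rfl] at this
  exact gen_h_ne_zero hA i this.symm

theorem exists_ad_f_pow_eq_zero (i : Fin n) (x : KacMoody A S) :
    ∃ m, (LieAlgebra.ad ℂ (KacMoody A S) (gen A S (.f i)) ^ m) x = 0 := by
  rw [← LieSubalgebra.mem_engel_iff]
  refine FreeLieAlgebra.mem_of_forall_mk_mem (relIdeal A S) _ (fun g => ?_) x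
  rw [LieSubalgebra.mem_engel_iff, ← gen_eq]
  have hh : ∀ j, ∃ c : ℂ, ⁅gen A S (.f i), gen A S (.h j)⁆ = c • gen A S (.f i) := fun j =>
    ⟨A j i, by rw [← lie_skew, h_lie_f, neg_neg]⟩
  cases g with
  | h j =>
    obtain ⟨c, hc⟩ := hh j
    exact ⟨2, by simp [pow_succ, hc]⟩
  | D j =>
    refine ⟨2, ?_⟩
    simp only [pow_succ, pow_zero, one_mul, Module.End.mul_apply, LieAlgebra.ad_apply,
      ← lie_skew _ (gen A S (.D j)), D_lie_f]
    simp [-ite_smul]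
  | e j =>
    obtain ⟨c, hc⟩ := hh j
    -- Up to scalars `ad f_i` sends `e_i` to `h_i`, then to `f_i`, then to `0`.
    refine ⟨3, ?_⟩
    have h1 : ⁅gen A S (.f i), gen A S (.e j)⁆ = -(if j = i then gen A S (.h j) else 0) := by
      rw [← lie_skew, e_lie_f]
    simp only [pow_succ, pow_zero, one_mul, Module.End.mul_apply, LieAlgebra.ad_apply, h1]
    split_ifs <;> simp [hc]
  | f j =>
    by_cases h : i = j
    · subst h
      exact ⟨1, by simp⟩
    · exact ⟨_, serre_f h⟩

theorem mem_rootSpace {α : Fin n → ℤ} {x : KacMoody A S} :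
    x ∈ rootSpace A S α ↔ (∀ i, ⁅gen A S (.h i), x⁆ = (corootPairing A i α : ℂ) • x) ∧
      ∀ j : {j // j ∈ S}, ⁅gen A S (.D j), x⁆ = ((α j.1 : ℤ) : ℂ) • x := Iff.rfl

theorem lie_mem_rootSpace {α β : Fin n → ℤ} {x y : KacMoody A S} (hx : x ∈ rootSpace A S α)
    (hy : y ∈ rootSpace A S β) : ⁅x, y⁆ ∈ rootSpace A S (α + β) := by
  rw [mem_rootSpace] at *
  refine ⟨fun i => ?_, fun j => ?_⟩
  · rw [leibniz_lie, hx.1, hy.1, smul_lie, lie_smul, ← add_smul, corootPairing, corootPairing,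
      corootPairing, ← Int.cast_add, ← Finset.sum_add_distrib]
    simp [mul_add]
  · rw [leibniz_lie, hx.2, hy.2, smul_lie, lie_smul, ← add_smul]
    simp

theorem e_mem_rootSpace (i : Fin n) : gen A S (.e i) ∈ rootSpace A S (Pi.single i 1) := by
  refine ⟨fun k => ?_, fun j => ?_⟩
  · rw [h_lie_e]
    simp [Pi.single_apply]
  · rw [D_lie_e]
    simp [Pi.single_apply, eq_comm]

theorem f_mem_rootSpace (i : Fin n) : gen A S (.f i) ∈ rootSpace A S (-Pi.single i 1) := by
  refine ⟨fun k => ?_, fun j => ?_⟩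
  · rw [h_lie_f]
    simp [Pi.single_apply]
  · rw [D_lie_f]
    simp [Pi.single_apply, eq_comm]

theorem isSl2String (hA : IsGenCartan A) (i : Fin n) (α : Fin n → ℤ) :
    IsSl2String (fun r => rootSpace A S (α + r • Pi.single i 1))
      (LieAlgebra.ad ℂ (KacMoody A S) (gen A S (.e i)))
      (LieAlgebra.ad ℂ (KacMoody A S) (gen A S (.f i))) (corootPairing A i α) where
  mapE r x hx := by
    have := lie_mem_rootSpace (e_mem_rootSpace i) hx
    rwa [add_comm, add_assoc, ← add_one_zsmul] at this
  mapF r x hx := by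
    have := lie_mem_rootSpace (f_mem_rootSpace i) hx
    rw [add_comm, add_assoc, ← sub_eq_add_neg] at this
    rwa [sub_smul, one_smul]
  comm r x hx := by
    simp only [LieAlgebra.ad_apply]
    rw [← lie_lie, e_lie_f, if_pos rfl, (mem_rootSpace.1 hx).1, corootPairing_add_smul hA]

/-- If `β` is a weight of the adjoint representation with `⟨β, α_i^∨⟩ < 0`, then so are
`β + k ε_i`, for `k ≤ -⟨β, α_i^∨⟩`. -/
theorem rootSpace_add_ne_bot (hA : IsGenCartan A) (i : Fin n) {β : Fin n → ℤ} {k m : ℕ}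
    (hk : k ≤ m) (hm : corootPairing A i β = -m) (hβ : rootSpace A S β ≠ ⊥) :
    rootSpace A S (β + (k : ℤ) • Pi.single i 1) ≠ ⊥ := by
  obtain ⟨x, hx, hx0⟩ := Submodule.exists_mem_ne_zero_of_ne_bot hβ
  have h := isSl2String (S := S) hA i β
  rw [hm] at h
  have hx' : x ∈ rootSpace A S (β + (0 : ℤ) • Pi.single i 1) := by simpa using hx
  obtain ⟨l, hl⟩ := exists_ad_f_pow_eq_zero i x
  have h1 := h.pow_mem hx' k
  intro h2
  rw [zero_add, h2, Submodule.mem_bot] at h1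
  exact hx0 (h.eq_zero_of_E_pow hx' hk h1 hl)

end KacMoody

/-! ### Loop algebras -/

namespace LieAlgebra.LoopAlgebra

variable {L L' : Type*} [LieRing L] [LieAlgebra ℂ L] [LieRing L'] [LieAlgebra ℂ L']

/-- The element `x ⊗ t^k` of the loop algebra. -/
def monomial (k : ℤ) : L →ₗ[ℂ] LieAlgebra.loopAlgebra ℂ ℤ L :=
  TensorProduct.mk ℂ _ _ (AddMonoidAlgebra.single k (1 : ℂ) : AddMonoidAlgebra ℂ ℤ)

theorem lie_monomial (x y : L) (k l : ℤ) :
    ⁅monomial k x, monomial l y⁆ = monomial (k + l) ⁅x, y⁆ := by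
  simp only [monomial, TensorProduct.mk_apply]
  rw [LieAlgebra.ExtendScalars.bracket_tmul, AddMonoidAlgebra.single_mul_single, one_mul]

theorem toFinsupp_monomial (x : L) (k : ℤ) :
    toFinsupp ℂ ℤ L (monomial k x) = Finsupp.single k x := toFinsupp_single_tmul ℂ ℤ L k x

theorem span_monomial (N : Submodule ℂ (LieAlgebra.loopAlgebra ℂ ℤ L))
    (h : ∀ k x, monomial k x ∈ N) (y : LieAlgebra.loopAlgebra ℂ ℤ L) : y ∈ N := by
  obtain ⟨f, rfl⟩ := (toFinsupp ℂ ℤ L).symm.surjective y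
  induction f using Finsupp.induction_linear with
  | zero => simp
  | add f g hf hg => rw [map_add]; exact N.add_mem hf hg
  | single k x => rw [toFinsupp_symm_single]; exact h k x

theorem isCurrentFamily_monomial {ι : Type*} (e : ι → L) :
    IsCurrentFamily fun i k => monomial k (e i) := by
  intro i j k l
  rw [lie_monomial, lie_monomial, add_right_comm, add_assoc]

theorem ad_pow_monomial (x y : L) (l : ℤ) (m : ℕ) :
    (LieAlgebra.ad ℂ _ (monomial 0 x) ^ m) (monomial l y) =
      monomial l ((LieAlgebra.ad ℂ L x ^ m) y) := by
  induction m with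
  | zero => rfl
  | succ m ih =>
    rw [pow_succ', Module.End.mul_apply, ih, LieAlgebra.ad_apply, lie_monomial, zero_add, pow_succ',
      Module.End.mul_apply, LieAlgebra.ad_apply]

end LieAlgebra.LoopAlgebra

open LieAlgebra.LoopAlgebra

/-! ### The morphisms to the loop algebras -/

section Loop

variable {n : ℕ} (A : Matrix (Fin n) (Fin n) ℤ) (S : Finset (Fin n))

theorem KacMoody.ad_pow_nGen {i j : Fin n} (hij : i ≠ j) :
    (LieAlgebra.ad ℂ (KacMoody.nPlus A S) (KacMoody.nGen A S i) ^ serreLen A i j)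
      (KacMoody.nGen A S j) = 0 := by
  apply Subtype.coe_injective
  have := LieHom.map_ad_pow (KacMoody.nPlus A S).incl (KacMoody.nGen A S i) (KacMoody.nGen A S j)
    (serreLen A i j)
  exact this.trans (KacMoody.serre_e hij)

/-- The morphism `j₊ : F̃₊ → L𝔫₊`. -/
def FPlus.toLnPlus : FPlus A →ₗ⁅ℂ⁆ KacMoody.LnPlus A S :=
  FPlus.lift A (fun i k => monomial k (KacMoody.nGen A S i)) (isCurrentFamily_monomial _)
    fun i j hij l => by rw [ad_pow_monomial, KacMoody.ad_pow_nGen A S hij, map_zero]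

/-- The composition of `j₊` with the inclusion of `L𝔫₊` in the loop algebra of `𝔤`. -/
def FPlus.toLoop : FPlus A →ₗ⁅ℂ⁆ LieAlgebra.loopAlgebra ℂ ℤ (KacMoody A S) :=
  FPlus.lift A (fun i k => monomial k (KacMoody.gen A S (.e i))) (isCurrentFamily_monomial _)
    fun i j hij l => by rw [ad_pow_monomial, KacMoody.serre_e hij, map_zero]

variable {A S}

namespace FPlus

theorem toLnPlus_gen (i : Fin n) (k : ℤ) :
    toLnPlus A S (gen A i k) = monomial k (KacMoody.nGen A S i) := lift_gen _ _ _ i k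

theorem toLoop_gen (i : Fin n) (k : ℤ) :
    toLoop A S (gen A i k) = monomial k (KacMoody.gen A S (.e i)) := lift_gen _ _ _ i k

theorem map_toLnPlus (x : FPlus A) :
    LieAlgebra.ExtendScalars.map (AlgHom.id ℂ (AddMonoidAlgebra ℂ ℤ)) (KacMoody.nPlus A S).incl
      (toLnPlus A S x) = toLoop A S x := by
  have : (LieAlgebra.ExtendScalars.map (AlgHom.id ℂ (AddMonoidAlgebra ℂ ℤ))
      (KacMoody.nPlus A S).incl).comp (toLnPlus A S) = toLoop A S := by
    refine hom_ext fun i k => ?_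
    rw [LieHom.comp_apply, toLnPlus_gen, toLoop_gen]
    rfl
  rw [← this]
  rfl

/-- The kernel is studied through `toLoop` because its target contains loops of `h_i`, `D_j` and
`f_i`, whose brackets can be compared with operators on F̃₊. -/
theorem toLoop_eq_zero {x : FPlus A} (hx : toLnPlus A S x = 0) : toLoop A S x = 0 := by
  rw [← map_toLnPlus, hx, map_zero]

theorem toLnPlus_surjective : Function.Surjective (toLnPlus A S) := by
  have h : ∀ x (hx : x ∈ KacMoody.nPlus A S) (k : ℤ),
      monomial k (⟨x, hx⟩ : KacMoody.nPlus A S) ∈ (toLnPlus A S).range := by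
    intro x hx
    induction hx using LieSubalgebra.lieSpan_induction with
    | mem x hx =>
      obtain ⟨i, rfl⟩ := hx
      exact fun k => ⟨gen A i k, toLnPlus_gen i k⟩
    | zero =>
      intro k
      rw [show (⟨0, _⟩ : KacMoody.nPlus A S) = 0 from rfl, map_zero]
      exact LieSubalgebra.zero_mem _
    | add x y hx hy ihx ihy =>
      intro k
      have := add_mem (ihx k) (ihy k)
      rwa [← map_add] at this
    | smul c x hx ih =>
      intro k
      have := LieSubalgebra.smul_mem _ c (ih k)
      rwa [← map_smul] at this
    | lie x y hx hy ihx ihy =>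
      intro k
      -- `[x, y] ⊗ t^k` is the bracket of `x ⊗ t^k` and `y ⊗ t^0`.
      have := LieSubalgebra.lie_mem _ (ihx k) (ihy 0)
      rwa [lie_monomial, add_zero] at this
  intro y
  exact span_monomial (toLnPlus A S).range.toSubmodule (fun k x => h x.1 x.2 k) y

theorem IsMonomial.toLnPlus {α : Fin n → ℤ} {x : FPlus A} (hx : IsMonomial A α x) :
    ∃ y ∈ KacMoody.nPart A S α, ∃ k, FPlus.toLnPlus A S x = monomial k y := by
  induction hx with
  | gen i k => exact ⟨KacMoody.nGen A S i, KacMoody.e_mem_rootSpace i, k, toLnPlus_gen i k⟩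
  | lie _ _ hx hy =>
    obtain ⟨x', hx', k, hk⟩ := hx
    obtain ⟨y', hy', l, hl⟩ := hy
    exact ⟨⁅x', y'⁆, KacMoody.lie_mem_rootSpace hx' hy', k + l,
      by rw [LieHom.map_lie, hk, hl, lie_monomial]⟩

theorem toLnPlus_mem_LnPart {α : Fin n → ℤ} {x : FPlus A} (hx : x ∈ part A α) :
    toLnPlus A S x ∈ KacMoody.LnPart A S α := by
  induction hx using Submodule.span_induction with
  | mem x hx =>
    obtain ⟨y, hy, k, hk⟩ := hx.toLnPlus (S := S)
    exact Submodule.subset_span ⟨y, hy, k, hk⟩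
  | zero => rw [map_zero]; exact Submodule.zero_mem _
  | add x y _ _ hx hy => rw [map_add]; exact Submodule.add_mem _ hx hy
  | smul t x _ hx => rw [map_smul]; exact Submodule.smul_mem _ _ hx

/-! ### Compatibility with the action of `𝔤` -/

section Intertwine

variable {L : Type*} [LieRing L] [LieAlgebra ℂ L] (f : FPlus A →ₗ⁅ℂ⁆ L)

/-- A morphism from `F̃₊` intertwines a derivation of `F̃₊` with a bracket if it does so on the
generators. -/
theorem map_deriv {y : L} {c : Fin n → ℂ} {k : ℤ}
    (h : ∀ j l, ⁅y, f (gen A j l)⁆ = c j • f (gen A j (l + k))) (u : FPlus A) :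
    f (deriv A c k u) = ⁅y, f u⁆ := by
  let K : LieSubalgebra ℂ (FPlus A) :=
    { carrier := {u | f (deriv A c k u) = ⁅y, f u⁆}
      add_mem' := fun {u v} (hu : _ = _) (hv : _ = _) => by
        change _ = _
        rw [map_add, map_add, hu, hv, map_add, lie_add]
      zero_mem' := by
        change _ = _
        simp
      smul_mem' := fun t u (hu : _ = _) => by
        change _ = _
        rw [map_smul, map_smul, hu, map_smul, lie_smul]
      lie_mem' := fun {u v} (hu : _ = _) (hv : _ = _) => by
        change _ = _
        rw [deriv_lie, map_sub, LieHom.map_lie, LieHom.map_lie, LieHom.map_lie, hu, hv,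
          leibniz_lie y, ← lie_skew (f v), sub_neg_eq_add, add_comm] }
  refine mem_of_gen_mem K (fun j l => ?_) u
  change _ = _
  rw [deriv_gen, map_smul, h]

theorem map_lie_eq_zero (u : FPlus A) {v : FPlus A} (hv : f v = 0) : f ⁅u, v⁆ = 0 := by
  rw [LieHom.map_lie, hv, lie_zero]

theorem map_deriv_eq_zero {y : L} {c : Fin n → ℂ} {k : ℤ}
    (h : ∀ j l, ⁅y, f (gen A j l)⁆ = c j • f (gen A j (l + k))) {u : FPlus A} (hu : f u = 0) :
    f (deriv A c k u) = 0 := by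
  rw [map_deriv f h, hu, lie_zero]

variable {f} {i : Fin n} {y : ℤ → L}

theorem map_cartan
    (h : ∀ k j l, ⁅y k, f (gen A j l)⁆ = (A i j : ℂ) • f (gen A j (l + k)))
    (c : ℤ →₀ ℂ) (u : FPlus A) :
    f (cartan A i c u) = ⁅Finsupp.linearCombination ℂ y c, f u⁆ := by
  induction c using Finsupp.induction_linear with
  | zero => simp
  | add c d hc hd => rw [map_add, LinearMap.add_apply, map_add, hc, hd, map_add, add_lie]
  | single k t =>
    rw [cartan_single, LinearMap.smul_apply, map_smul, map_deriv f (h k)]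
    simp

/-- If `z` and `y k` bracket with the images of the generators as `f_i[0]` and `h_i[k]` should, then
extending `f` by `h_i[k] ↦ y k` turns `lower` into the bracket with `z`. In particular lowering
preserves the kernel of `f` outside degree `ε_i`. -/
theorem map_lower
    (h : ∀ k j l, ⁅y k, f (gen A j l)⁆ = (A i j : ℂ) • f (gen A j (l + k)))
    (hA : IsGenCartan A) {z : L}
    (hz : ∀ j l, ⁅z, f (gen A j l)⁆ = if j = i then -y l else 0) (u : FPlus A) :
    f (lower hA i u).1 + Finsupp.linearCombination ℂ y (lower hA i u).2 = ⁅z, f u⁆ := by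
  let K : LieSubalgebra ℂ (FPlus A) :=
    { carrier := {u | f (lower hA i u).1 + Finsupp.linearCombination ℂ y (lower hA i u).2 =
        ⁅z, f u⁆}
      add_mem' := fun {u v} (hu : _ = _) (hv : _ = _) => by
        change _ = _
        rw [map_add, map_add, lie_add, ← hu, ← hv, Prod.fst_add, Prod.snd_add, map_add, map_add]
        abel
      zero_mem' := by
        change _ = _
        simp
      smul_mem' := fun t u (hu : _ = _) => by
        change _ = _
        rw [map_smul, map_smul, lie_smul, ← hu, Prod.smul_fst, Prod.smul_snd, map_smul, map_smul,
          smul_add]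
      lie_mem' := fun {u v} (hu : _ = _) (hv : _ = _) => by
        change _ = _
        have hu' := eq_sub_of_add_eq hu
        have hv' := eq_sub_of_add_eq hv
        rw [lower_lie, map_sub, map_sub, map_sub, LieHom.map_lie, LieHom.map_lie, LieHom.map_lie,
          hu', hv', map_cartan h, map_cartan h, map_zero, add_zero, lie_sub, lie_sub,
          ← lie_skew (f u) (Finsupp.linearCombination ℂ y _),
          ← lie_skew (f v) (Finsupp.linearCombination ℂ y _), leibniz_lie z, ← lie_skew (f v) ⁅_, _⁆]
        abel }
  refine mem_of_gen_mem K (fun j l => ?_) u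
  change _ = _
  rw [lower_gen, hz, map_zero, zero_add]
  split_ifs <;> simp

theorem map_lowerEnd_eq_zero
    (h : ∀ k j l, ⁅y k, f (gen A j l)⁆ = (A i j : ℂ) • f (gen A j (l + k)))
    (hA : IsGenCartan A) {z : L}
    (hz : ∀ j l, ⁅z, f (gen A j l)⁆ = if j = i then -y l else 0) {α : Fin n → ℤ} {x : FPlus A}
    (hx : x ∈ part A α) (hα : α ≠ Pi.single i 1) (h0 : f x = 0) : f (lowerEnd hA i x) = 0 := by
  have := map_lower h hA hz x
  rw [lower_snd_eq_zero hA i hx hα, map_zero, add_zero, h0, lie_zero] at this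
  exact this

end Intertwine

theorem toLoop_lie_gen {y : KacMoody A S} {c : Fin n → ℂ}
    (h : ∀ j, ⁅y, KacMoody.gen A S (.e j)⁆ = c j • KacMoody.gen A S (.e j)) (k : ℤ)
    (j : Fin n) (l : ℤ) :
    ⁅monomial k y, toLoop A S (gen A j l)⁆ = c j • toLoop A S (gen A j (l + k)) := by
  rw [toLoop_gen, toLoop_gen, lie_monomial, h, map_smul, add_comm]

theorem toLoop_lowerEnd_eq_zero (hA : IsGenCartan A) (i : Fin n) {α : Fin n → ℤ} {x : FPlus A}
    (hx : x ∈ part A α) (hα : α ≠ Pi.single i 1) (h0 : toLoop A S x = 0) :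
    toLoop A S (lowerEnd hA i x) = 0 := by
  refine map_lowerEnd_eq_zero (f := toLoop A S) (i := i)
    (y := fun k => monomial k (KacMoody.gen A S (.h i)))
    (fun k j l => toLoop_lie_gen (KacMoody.h_lie_e i) k j l) hA
    (z := monomial 0 (KacMoody.gen A S (.f i))) (fun j l => ?_) hx hα h0
  rw [toLoop_gen]
  refine (lie_monomial _ _ _ _).trans ?_
  rw [← lie_skew, KacMoody.e_lie_f, zero_add]
  split_ifs with h
  · simp [h]
  · simp

/-- `j₊` is injective in simple degrees. -/
theorem eq_zero_of_toLoop_eq_zero (hA : IsGenCartan A) (i : Fin n) {x : FPlus A}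
    (hx : x ∈ part A (Pi.single i 1)) (h : toLoop A S x = 0) : x = 0 := by
  obtain ⟨c, rfl⟩ := (Finsupp.mem_span_range_iff_exists_finsupp).1 (part_single_le i hx)
  have hc : ∀ k, c k = 0 := by
    intro k
    have h1 := congrArg (fun f => toFinsupp ℂ ℤ _ f k) h
    simp only [Finsupp.sum, map_sum, map_smul, toLoop_gen, toFinsupp_monomial, map_zero,
      Finsupp.coe_zero, Pi.zero_apply, Finsupp.coe_finsetSum, Finset.sum_apply,
      Finsupp.smul_apply, Finsupp.single_apply] at h1
    rw [Finset.sum_eq_single k] at h1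
    · rw [if_pos rfl] at h1
      exact (smul_eq_zero.1 h1).resolve_right (KacMoody.gen_e_ne_zero hA i)
    · intro l _ hl
      simp [hl]
    · intro hk
      simp [Finsupp.notMem_support_iff.1 hk]
  have : c = 0 := Finsupp.ext hc
  simp [this]

/-! ### Reflections -/

theorem exists_ne_of_mem_part {α : Fin n → ℤ} {x : FPlus A} (hx : x ∈ part A α) (hx0 : x ≠ 0)
    {i : Fin n} (hα : α ≠ Pi.single i 1) : ∃ j, j ≠ i ∧ α j ≠ 0 := by
  by_contra! h
  rw [part_eq_bot_of_support i h hα] at hx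
  exact hx0 hx

/-- Lowering from degree `α` with `⟨α, α_i^∨⟩ ≥ 0` to degree `s_i α`. -/
theorem exists_reflection_of_nonneg (hA : IsGenCartan A) {i : Fin n} {α : Fin n → ℤ}
    {x : FPlus A} (hx : x ∈ part A α) (hx0 : x ≠ 0) (hα : α ≠ Pi.single i 1) {p : ℕ}
    (hp : corootPairing A i α = p) :
    ∃ y ∈ part A (α - (p : ℤ) • Pi.single i 1), y ≠ 0 ∧
      (toLoop A S x = 0 → toLoop A S y = 0) := by
  obtain ⟨j, hj, hj'⟩ := exists_ne_of_mem_part hx hx0 hα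
  have h := isSl2String hA i α ⟨j, hj, hj'⟩
  rw [hp] at h
  have hx' : x ∈ part A (α + (0 : ℤ) • Pi.single i 1) := by simpa using hx
  have hmem : ∀ r : ℕ, (lowerEnd hA i ^ r) x ∈ part A (α - (r : ℤ) • Pi.single i 1) := by
    intro r
    have := h.swap.pow_mem (r := 0) (by simpa using hx) r
    simpa [← sub_eq_add_neg] using this
  refine ⟨(lowerEnd hA i ^ p) x, hmem p, fun h0 => hx0 ?_, fun h0 => ?_⟩
  -- The lowered vector is nonzero because `ad x_i[0]` is locally nilpotent and `x` has weight `p`.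
  · obtain ⟨l, hl⟩ := exists_ad_pow_eq_zero i x
    exact h.eq_zero_of_F_pow hx' le_rfl h0 hl
  · clear hp h
    induction p with
    | zero => exact h0
    | succ p ih =>
      rw [pow_succ', Module.End.mul_apply]
      refine toLoop_lowerEnd_eq_zero hA i (hmem p) (fun h1 => ?_) ih
      have := congrFun h1 j
      simp [hj] at this
      exact hj' this

/-- Raising from degree `α` with `⟨α, α_i^∨⟩ ≤ 0` to degree `s_i α`. -/
theorem exists_reflection_of_nonpos (hA : IsGenCartan A) {i : Fin n} {α : Fin n → ℤ}
    {x : FPlus A} (hx : x ∈ part A α) (hx0 : x ≠ 0) (hα : α ≠ Pi.single i 1) {p : ℕ}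
    (hp : corootPairing A i α = -p) :
    ∃ y ∈ part A (α + (p : ℤ) • Pi.single i 1), y ≠ 0 ∧
      (toLoop A S x = 0 → toLoop A S y = 0) := by
  have h := isSl2String hA i α (exists_ne_of_mem_part hx hx0 hα)
  rw [hp] at h
  have hx' : x ∈ part A (α + (0 : ℤ) • Pi.single i 1) := by simpa using hx
  refine ⟨_, by simpa using h.pow_mem hx' p, fun h0 => hx0 ?_, fun h0 => ?_⟩
  · obtain ⟨l, hl⟩ := exists_lowerEnd_pow_eq_zero hA i hx
    exact h.eq_zero_of_E_pow hx' le_rfl h0 hl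
  · clear hp h
    induction p with
    | zero => exact h0
    | succ p ih =>
      rw [pow_succ', Module.End.mul_apply, LieAlgebra.ad_apply]
      exact map_lie_eq_zero _ _ ih

/-- The degrees in which `j₊` is not injective. -/
def IsKerDegree (A : Matrix (Fin n) (Fin n) ℤ) (S : Finset (Fin n)) (α : Fin n → ℤ) : Prop :=
  ∃ x ∈ part A α, x ≠ 0 ∧ toLoop A S x = 0

theorem IsKerDegree.ne_single (hA : IsGenCartan A) {α : Fin n → ℤ} (h : IsKerDegree A S α)
    (i : Fin n) : α ≠ Pi.single i 1 := by
  rintro rfl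
  obtain ⟨x, hx, hx0, hx'⟩ := h
  exact hx0 (eq_zero_of_toLoop_eq_zero hA i hx hx')

/-- The 𝔰𝔩₂ strings carry a nonzero kernel vector to degree `s_i α`. The exceptional degree `ε_i`
does not occur, since j₊ is injective there. -/
theorem IsKerDegree.reflection (hA : IsGenCartan A) {α : Fin n → ℤ} (h : IsKerDegree A S α)
    (i : Fin n) : IsKerDegree A S (KacMoody.reflection A i α) := by
  have hα := h.ne_single hA i
  obtain ⟨x, hx, hx0, hx'⟩ := h
  rw [KacMoody.reflection_apply]
  change IsKerDegree A S (α - corootPairing A i α • Pi.single i 1)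
  rcases (corootPairing A i α).eq_nat_or_neg with ⟨p, hp | hp⟩
  · obtain ⟨y, hy, hy0, hy'⟩ := exists_reflection_of_nonneg (S := S) hA hx hx0 hα hp
    exact ⟨y, by rwa [hp], hy0, hy' hx'⟩
  · obtain ⟨y, hy, hy0, hy'⟩ := exists_reflection_of_nonpos (S := S) hA hx hx0 hα hp
    exact ⟨y, by rwa [hp, neg_smul, sub_neg_eq_add], hy0, hy' hx'⟩

theorem _root_.KacMoody.reflection_reflection (hA : IsGenCartan A) (i : Fin n) (α : Fin n → ℤ) :
    KacMoody.reflection A i (KacMoody.reflection A i α) = α := by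
  have h : ∀ β, KacMoody.reflection A i β = β + (-corootPairing A i β) • Pi.single i 1 := fun β => by
    rw [KacMoody.reflection_apply, neg_smul, ← sub_eq_add_neg]
    rfl
  rw [h, h α, corootPairing_add_smul hA, add_assoc, ← add_smul]
  convert add_zero α
  convert zero_smul ℤ _
  ring

/-- `j₊` is injective in real degrees. -/
theorem not_isKerDegree_of_isReal (hA : IsGenCartan A) {α : Fin n → ℤ}
    (hα : KacMoody.IsReal A α) : ¬ IsKerDegree A S α := by
  obtain ⟨w, hw, i, rfl⟩ := hα
  suffices h : ∀ β, IsKerDegree A S (w β) → IsKerDegree A S β from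
    fun h' => (h _ h').ne_single hA i rfl
  induction hw using Submonoid.closure_induction with
  | mem w hw =>
    obtain ⟨k, rfl⟩ := hw
    intro β hβ
    rw [← KacMoody.reflection_reflection hA k β]
    exact hβ.reflection hA k
  | one => exact fun β hβ => hβ
  | mul w w' _ _ hw hw' => exact fun β hβ => hw' _ (hw _ hβ)

/-! ### The degrees of `F̃₊` are roots -/

/-- Induction on the height: a smaller degree of F̃₊ is found on the `i`-string of `α`, it is a
weight of 𝔤 by induction, and the 𝔰𝔩₂ theory in 𝔤 climbs back to `α`. -/
theorem rootSpace_ne_bot (hA : IsGenCartan A) {α : Fin n → ℤ} (hα : part A α ≠ ⊥) :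
    KacMoody.rootSpace A S α ≠ ⊥ := by
  obtain ⟨N, hN⟩ : ∃ N : ℕ, ∑ i, α i ≤ N := ⟨_, Int.self_le_toNat _⟩
  induction N generalizing α with
  | zero =>
    have h := not_not.1 fun h => hα (part_eq_bot_of_not_nonneg h)
    have h0 : ∑ i, α i = 0 := le_antisymm hN (Finset.sum_nonneg fun i _ => h.1 i)
    exact absurd (funext fun i => (Finset.sum_eq_zero_iff_of_nonneg fun i _ => h.1 i).1 h0 i
      (Finset.mem_univ i)) h.2
  | succ N ih =>
    have hsum : ∀ (i : Fin n) (p : ℤ), ∑ j, (α - p • Pi.single i 1 : Fin n → ℤ) j = ∑ j, α j - p := by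
      intro i p
      simp [Finset.sum_sub_distrib, Pi.single_apply]
    by_cases h1 : ∃ i, α = Pi.single i 1
    · obtain ⟨i, rfl⟩ := h1
      intro h
      have := KacMoody.e_mem_rootSpace (A := A) (S := S) i
      rw [h] at this
      exact KacMoody.gen_e_ne_zero hA i this
    push Not at h1
    obtain ⟨i, hi⟩ := exists_part_sub_ne_bot hα h1
    -- If the pairing is at most 1, then `α - ε_i` has negative pairing and one step up stays among
    -- the weights of 𝔤. Otherwise F̃₊ is lowered from `α` to `s_i α`, and 𝔤 is raised back by the
    -- full reflection.
    rcases le_or_gt (corootPairing A i α) 1 with hp | hp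
    · have h2 := ih hi (by have := hsum i 1; rw [one_smul] at this; push_cast at hN; omega)
      have h3 : corootPairing A i (α - Pi.single i 1) = corootPairing A i α - 2 := by
        have := corootPairing_add_smul hA i α (-1)
        rw [neg_one_smul, ← sub_eq_add_neg] at this
        rw [this]
        ring
      have h4 := KacMoody.rootSpace_add_ne_bot (S := S) hA i (k := 1)
        (m := (2 - corootPairing A i α).toNat) (by omega) (by rw [h3]; omega) h2
      simpa using h4
    · obtain ⟨x, hx, hx0⟩ := Submodule.exists_mem_ne_zero_of_ne_bot hα
      obtain ⟨p, hp'⟩ : ∃ p : ℕ, corootPairing A i α = p :=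
        ⟨(corootPairing A i α).toNat, by omega⟩
      obtain ⟨y, hy, hy0, -⟩ := exists_reflection_of_nonneg (S := S) hA hx hx0 (h1 i) hp'
      have h2 : part A (α - (p : ℤ) • Pi.single i 1) ≠ ⊥ := fun h => by
        rw [h] at hy
        exact hy0 hy
      have h3 := ih h2 (by rw [hsum]; push_cast at hN; omega)
      have h4 : corootPairing A i (α - (p : ℤ) • Pi.single i 1) = -(p : ℤ) := by
        have := corootPairing_add_smul hA i α (-p)
        rw [neg_smul, ← sub_eq_add_neg] at this
        rw [this]
        omega
      have h5 := KacMoody.rootSpace_add_ne_bot (S := S) hA i le_rfl h4 h3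
      simpa using h5

theorem mem_posRoots (hA : IsGenCartan A) {α : Fin n → ℤ} (hα : part A α ≠ ⊥) :
    α ∈ KacMoody.posRoots A S := by
  have h := not_not.1 fun h => hα (part_eq_bot_of_not_nonneg h)
  exact ⟨h.2, h.1, rootSpace_ne_bot hA hα⟩

/-- The derivations `x_j[l] ↦ δ_jk x_j[l]` read off the coordinates of the degree; the eigenvector
lemma is applied to the zero subspace. -/
theorem iSupIndep_part (A : Matrix (Fin n) (Fin n) ℤ) : iSupIndep (part A) := by
  rw [iSupIndep_iff_finsetSum_eq_zero_imp_eq_zero]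
  intro s x hx hs
  have h := Submodule.mem_of_sum_eigenvectors_mem (⊥ : Submodule ℂ (FPlus A))
    (fun k : Fin n => deriv A (Pi.single k 1) 0) (by simp) (fun k α => (α k : ℂ))
    (fun α β h => funext fun k => Int.cast_injective (h k)) s x
    (fun α hα k => by rw [deriv_zero_eq_smul _ (hx α hα)]; simp [Pi.single_apply]) (by simp [hs])
  exact fun α hα => h α hα

theorem isInternal_part (hA : IsGenCartan A) (S : Finset (Fin n)) :
    DirectSum.IsInternal (fun α : KacMoody.posRoots A S => part A α.1) := by
  rw [DirectSum.isInternal_submodule_iff_iSupIndep_and_iSup_eq_top]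
  refine ⟨(iSupIndep_part A).comp Subtype.val_injective, ?_⟩
  rw [eq_top_iff, ← iSup_part A]
  refine iSup_le fun α => ?_
  by_cases hα : part A α = ⊥
  · rw [hα]
    exact bot_le
  · exact le_iSup (fun α : KacMoody.posRoots A S => part A α.1) ⟨α, mem_posRoots hA hα⟩

/-- The weights of the Cartan subalgebra separate the elements of the root lattice. -/
theorem _root_.IsCorankSet.eq_of_weights_eq (hS : IsCorankSet A S) {α β : Fin n → ℤ}
    (h : ∀ i, corootPairing A i α = corootPairing A i β) (h' : ∀ j ∈ S, α j = β j) : α = β := by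
  have h1 : ∀ i, ∑ j, A i j * (α j - β j) = 0 := by
    intro i
    have := h i
    simp only [corootPairing] at this
    simp only [mul_sub, Finset.sum_sub_distrib, this, sub_self]
  have h2 : ∀ i, ∑ j : {j // j ∉ S}, A i j * (α j - β j) = 0 := by
    intro i
    have h3 := Fintype.sum_subtype_add_sum_subtype (· ∈ S) fun j => A i j * (α j - β j)
    rw [h1 i, Finset.sum_eq_zero fun j _ => by rw [h' _ j.2, sub_self, mul_zero], zero_add] at h3
    exact h3
  have h3 : (fun j : {j // j ∉ S} => α j - β j) = 0 :=
    Matrix.eq_zero_of_mulVec_eq_zero hS.nondeg (funext fun i => h2 i)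
  funext j
  by_cases hj : j ∈ S
  · exact h' j hj
  · exact sub_eq_zero.1 (congrFun h3 ⟨j, hj⟩)

/-- Brackets with `h_i` and `D_j` correspond to diagonal derivations of F̃₊, so the kernel of
`toLoop` is stable under these. By the corank condition they separate degrees, so the kernel
contains the components of its elements; a nonzero one has a degree that is a root and cannot be
real. -/
theorem ker_toLnPlus_le (hA : IsGenCartan A) (hS : IsCorankSet A S) :
    (toLnPlus A S).ker.toSubmodule ≤ ⨆ α ∈ KacMoody.imPosRoots A S, part A α := by
  intro x hx
  have hx : toLoop A S x = 0 := toLoop_eq_zero hx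
  obtain ⟨f, hf, hfx⟩ := (Submodule.mem_iSup_iff_exists_finsupp (part A) x).1
    (by rw [iSup_part]; trivial)
  let N : Submodule ℂ (FPlus A) := (toLoop A S).ker.toSubmodule
  have hN : ∀ y, y ∈ N ↔ toLoop A S y = 0 := fun y => LieHom.mem_ker
  let T : Fin n ⊕ {j // j ∈ S} → Module.End ℂ (FPlus A) :=
    Sum.elim (fun i => deriv A (fun j => (A i j : ℂ)) 0)
      (fun j => deriv A (fun i => if i = j.1 then 1 else 0) 0)
  have h := Submodule.mem_of_sum_eigenvectors_mem N T (by
      rintro (i | j) y hy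
      · rw [hN] at *
        exact map_deriv_eq_zero _ (toLoop_lie_gen (KacMoody.h_lie_e i) 0) hy
      · rw [hN] at *
        exact map_deriv_eq_zero _ (toLoop_lie_gen (KacMoody.D_lie_e j) 0) hy)
    (Sum.elim (fun i α => (corootPairing A i α : ℂ)) (fun j α => (α j.1 : ℂ)))
    (fun α β h => hS.eq_of_weights_eq (fun i => Int.cast_injective (h (.inl i)))
      fun j hj => Int.cast_injective (h (.inr ⟨j, hj⟩)))
    f.support f (by
      rintro α - (i | j)
      · refine (deriv_zero_eq_smul _ (hf α)).trans ?_
        simp [corootPairing]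
      · refine (deriv_zero_eq_smul _ (hf α)).trans ?_
        simp) (by rw [hN]; rw [← hx, ← hfx]; rfl)
  rw [← hfx]
  refine Submodule.sum_mem _ fun α hα => ?_
  have h0 : f α ≠ 0 := Finsupp.mem_support_iff.1 hα
  refine Submodule.mem_iSup_of_mem α (Submodule.mem_iSup_of_mem ⟨mem_posRoots hA ?_, ?_⟩ (hf α))
  · intro hbot
    have := hf α
    rw [hbot] at this
    exact h0 this
  · exact fun hreal => not_isKerDegree_of_isReal (S := S) hA hreal ⟨f α, hf α, h0, h α hα⟩

end FPlus

end Loop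

/-! ### Sums over permutations -/

theorem Finset.exists_perm_map_eq {ι : Type*} [Fintype ι] [DecidableEq ι] {s t : Finset ι}
    (h : s.card = t.card) : ∃ σ : Equiv.Perm ι, s.map σ.toEmbedding = t := by
  let e := Finset.equivOfCardEq h
  refine ⟨e.extendSubtype, Finset.eq_of_subset_of_card_le (fun x hx => ?_) (by simp [h])⟩
  obtain ⟨y, hy, rfl⟩ := Finset.mem_map.1 hx
  exact e.extendSubtype_mem y hy

/-- Averaging over the images of a subset is averaging over the subsets of the same size. -/
theorem Finset.choose_nsmul_sum_perm {ι M : Type*} [Fintype ι] [DecidableEq ι] [AddCommMonoid M]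
    (g : Finset ι → M) (s : Finset ι) :
    (Fintype.card ι).choose s.card • ∑ σ : Equiv.Perm ι, g (s.map σ.toEmbedding) =
      (Fintype.card ι).factorial • ∑ t ∈ Finset.powersetCard s.card Finset.univ, g t := by
  have h1 : ∀ t ∈ Finset.powersetCard s.card (Finset.univ : Finset ι),
      ∑ σ : Equiv.Perm ι, g (t.map σ.toEmbedding) =
        ∑ σ : Equiv.Perm ι, g (s.map σ.toEmbedding) := by
    intro t ht
    obtain ⟨τ, rfl⟩ := Finset.exists_perm_map_eq (Finset.mem_powersetCard.1 ht).2.symm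
    refine Fintype.sum_equiv (Equiv.mulRight τ) _ _ fun σ => ?_
    rw [Finset.map_map]
    rfl
  have h2 : ∀ σ : Equiv.Perm ι,
      ∑ t ∈ Finset.powersetCard s.card Finset.univ, g (t.map σ.toEmbedding) =
        ∑ t ∈ Finset.powersetCard s.card Finset.univ, g t := by
    intro σ
    refine Finset.sum_nbij' (fun t => t.map σ.toEmbedding) (fun t => t.map σ.symm.toEmbedding)
      ?_ ?_ ?_ ?_ ?_
    · simp [Finset.mem_powersetCard]
    · simp [Finset.mem_powersetCard]
    · intro t _
      ext x
      simp
    · intro t _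
      ext x
      simp
    · simp
  -- Pairs of a subset and a permutation are summed in both orders.
  calc _ = ∑ t ∈ Finset.powersetCard s.card (Finset.univ : Finset ι),
        ∑ σ : Equiv.Perm ι, g (t.map σ.toEmbedding) := by
        rw [Finset.sum_congr rfl h1, Finset.sum_const, Finset.card_powersetCard, Finset.card_univ]
    _ = _ := by
        rw [Finset.sum_comm, Finset.sum_congr rfl fun σ _ => h2 σ, Finset.sum_const,
          Finset.card_univ, Fintype.card_perm]

/-- With commuting factors, only the image under `σ` of `{s | s < p}` matters. -/
theorem List.prod_take_ofFn_perm {C : Type*} [CommMonoid C] {m : ℕ} (a : Fin m → C)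
    (σ : Equiv.Perm (Fin m)) (p : ℕ) :
    ((List.ofFn fun s => a (σ s)).take p).prod =
        ∏ s ∈ (Finset.univ.filter fun s : Fin m => s.1 < p).map σ.toEmbedding, a s ∧
      ((List.ofFn fun s => a (σ s)).drop p).prod =
        ∏ s ∈ ((Finset.univ.filter fun s : Fin m => s.1 < p).map σ.toEmbedding)ᶜ, a s := by
  have key : ∀ l : List (Fin m), l.Nodup → (l.map fun s => a (σ s)).prod =
      ∏ s ∈ l.toFinset, a (σ s) := fun l hl => (List.prod_toFinset _ hl).symm
  have hm : ∀ x : Fin m, ∀ p, (x ∈ (List.finRange m).take p ↔ x.1 < p) ∧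
      (x ∈ (List.finRange m).drop p ↔ ¬ x.1 < p) := by
    intro x p
    constructor
    · rw [List.mem_take_iff_getElem]
      simp only [List.getElem_finRange, List.length_finRange, lt_min_iff]
      constructor
      · rintro ⟨j, hj, rfl⟩
        exact hj.1
      · exact fun h => ⟨x, ⟨h, x.2⟩, rfl⟩
    · rw [List.mem_drop_iff_getElem]
      simp only [List.getElem_finRange, List.length_finRange]
      constructor
      · rintro ⟨j, hj, rfl⟩
        simp
      · intro h
        exact ⟨x - p, by omega, Fin.ext (by simp; omega)⟩
  rw [List.ofFn_eq_map, ← List.map_take, ← List.map_drop,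
    key _ ((List.nodup_finRange m).sublist (List.take_sublist _ _)),
    key _ ((List.nodup_finRange m).sublist (List.drop_sublist _ _))]
  constructor
  · rw [Finset.prod_map]
    refine Finset.prod_congr ?_ fun _ _ => rfl
    ext x
    simp [hm]
  · rw [show ((Finset.univ.filter fun s : Fin m => s.1 < p).map σ.toEmbedding)ᶜ =
      (Finset.univ.filter fun s : Fin m => ¬ s.1 < p).map σ.toEmbedding by ext x; simp,
      Finset.prod_map]
    refine Finset.prod_congr ?_ fun _ _ => rfl
    ext x
    simp [hm]

section Symmetrization

variable {C E : Type*} [CommMonoid C] [Ring E] [Algebra ℂ E] (ρ : C →* E)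

/-- Each subset of size `p` arises from `p! (m - p)!` permutations, and the binomial coefficient
turns this into `m!` for every `p`. The monoid `C` records that the outer factors commute although
`E` does not. -/
theorem sum_perm_sum_range_choose (b : E) {m : ℕ} (a : Fin m → C) :
    ∑ σ : Equiv.Perm (Fin m), ∑ p ∈ Finset.range (m + 1), ((-1) ^ p * (m.choose p) : ℂ) •
      (ρ ((List.ofFn fun s => a (σ s)).take p).prod * b *
        ρ ((List.ofFn fun s => a (σ s)).drop p).prod) =
      (m.factorial : ℂ) • ∑ t ∈ (Finset.univ : Finset (Fin m)).powerset,
        (-1 : ℂ) ^ t.card • (ρ (∏ s ∈ t, a s) * b * ρ (∏ s ∈ tᶜ, a s)) := by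
  simp only [List.prod_take_ofFn_perm]
  rw [Finset.sum_comm, Finset.sum_powerset, Finset.card_univ, Fintype.card_fin, Finset.smul_sum]
  refine Finset.sum_congr rfl fun p hp => ?_
  have hc : (Finset.univ.filter fun s : Fin m => s.1 < p).card = p := by
    rw [Fin.card_filter_val_lt]
    have := Finset.mem_range.1 hp
    omega
  have h := Finset.choose_nsmul_sum_perm (fun t => ρ (∏ s ∈ t, a s) * b * ρ (∏ s ∈ tᶜ, a s))
    (Finset.univ.filter fun s : Fin m => s.1 < p)
  rw [hc, Fintype.card_fin, ← Nat.cast_smul_eq_nsmul ℂ, ← Nat.cast_smul_eq_nsmul ℂ] at h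
  rw [← Finset.smul_sum, mul_smul, h, smul_comm]
  congr 1
  rw [Finset.smul_sum]
  refine Finset.sum_congr rfl fun t ht => ?_
  rw [(Finset.mem_powersetCard.1 ht).2]

/-- The expansion of a product of commuting operators `ad`. -/
theorem sum_powerset_insert_eq {ι : Type*} [DecidableEq ι] (b : E) (a : ι → C) {s : ι}
    {T : Finset ι} (hs : s ∉ T) :
    ∑ t ∈ (insert s T).powerset,
        (-1 : ℂ) ^ t.card • (ρ (∏ r ∈ t, a r) * b * ρ (∏ r ∈ insert s T \ t, a r)) =
      -∑ t ∈ T.powerset,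
        (-1 : ℂ) ^ t.card • (ρ (∏ r ∈ t, a r) * ⁅ρ (a s), b⁆ * ρ (∏ r ∈ T \ t, a r)) := by
  rw [Finset.sum_powerset_insert hs, ← Finset.sum_add_distrib, ← Finset.sum_neg_distrib]
  refine Finset.sum_congr rfl fun t ht => ?_
  have hst : s ∉ t := fun h => hs (Finset.mem_powerset.1 ht h)
  rw [Finset.insert_sdiff_of_notMem _ hst, Finset.prod_insert (by simp [hs]),
    Finset.insert_sdiff_insert, Finset.sdiff_insert_of_notMem hs, Finset.card_insert_of_notMem hst,
    Finset.prod_insert hst, mul_comm (a s) (∏ r ∈ t, a r), map_mul, map_mul,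
    LieRing.of_associative_ring_bracket, pow_succ, mul_smul, ← smul_add, ← smul_neg]
  congr 1
  rw [neg_one_smul]
  noncomm_ring

end Symmetrization

/-- The expansion of a power of `ad x`. -/
theorem sum_range_choose_eq_ad_pow {E : Type*} [Ring E] [Algebra ℂ E] (x y : E) (m : ℕ) :
    ∑ p ∈ Finset.range (m + 1), ((-1) ^ p * (m.choose p) : ℂ) • (x ^ p * y * x ^ (m - p)) =
      (-1 : ℂ) ^ m • (LieAlgebra.ad ℂ E x ^ m) y := by
  let l : Module.End ℂ E := LinearMap.mulLeft ℂ x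
  let r : Module.End ℂ E := LinearMap.mulRight ℂ x
  let D : Module.End ℂ E := LieAlgebra.ad ℂ E x
  have h : -D = -l + r := by
    refine LinearMap.ext fun z => ?_
    simp [l, r, D, LieRing.of_associative_ring_bracket, sub_eq_add_neg, add_comm]
  have hlr : Commute (-l) r := (LinearMap.commute_mulLeft_right x x).neg_left
  have h2 : (-1 : ℂ) ^ m • (D ^ m) y = ((-D) ^ m) y := by
    rcases Nat.even_or_odd m with h' | h' <;> rw [h'.neg_one_pow, h'.neg_pow] <;> simp
  change _ = (-1 : ℂ) ^ m • (D ^ m) y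
  rw [h2, h, hlr.add_pow, LinearMap.sum_apply]
  refine Finset.sum_congr rfl fun p _ => ?_
  have h3 : ∀ z, (r ^ (m - p)) z = z * x ^ (m - p) := fun z => by
    simp only [r, LinearMap.pow_mulRight, LinearMap.mulRight_apply]
  have h4 : ∀ z, ((-l) ^ p) z = (-1 : ℂ) ^ p • (x ^ p * z) := fun z => by
    rcases Nat.even_or_odd p with h' | h' <;>
      rw [h'.neg_one_pow, h'.neg_pow] <;> simp [l, LinearMap.pow_mulLeft]
  rw [Module.End.mul_apply, Module.End.mul_apply, h3, h4, Module.End.natCast_apply,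
    ← Nat.cast_smul_eq_nsmul ℂ, mul_smul]
  simp only [smul_mul_assoc, mul_smul_comm, mul_assoc]

section Family

variable {ι E : Type*} [Ring E] [Algebra ℂ E] {x : ι → ℤ → E}

/-- Adding `s` to `T` pairs the subsets with and without `s` into `-[x_i[k_s], ·]`. This raises `r`
by one and shifts `l` by `k_s`, so both are kept general. -/
theorem IsCurrentFamily.sum_powerset_eq (hx : IsCurrentFamily x) {C : Type*} [CommMonoid C]
    (ρ : C →* E) (i j : ι) {m : ℕ} {a : Fin m → C} {k : Fin m → ℤ} (ha : ∀ s, ρ (a s) = x i (k s))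
    (T : Finset (Fin m)) (r : ℕ) (l : ℤ) :
    ∑ t ∈ T.powerset, (-1 : ℂ) ^ t.card • (ρ (∏ s ∈ t, a s) *
        (LieAlgebra.ad ℂ E (x i 0) ^ r) (x j l) * ρ (∏ s ∈ T \ t, a s)) =
      (-1 : ℂ) ^ T.card • (LieAlgebra.ad ℂ E (x i 0) ^ (r + T.card)) (x j (∑ s ∈ T, k s + l)) := by
  induction T using Finset.induction_on generalizing r l with
  | empty => simp
  | insert s T hs ih =>
    rw [sum_powerset_insert_eq ρ _ a hs, ha, hx.lie_ad_pow, ih, Finset.sum_insert hs,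
      Finset.card_insert_of_notMem hs, pow_succ (-1 : ℂ), mul_neg_one, neg_smul,
      show r + 1 + T.card = r + (T.card + 1) by ring,
      show ∑ s ∈ T, k s + (k s + l) = k s + ∑ s ∈ T, k s + l by ring]

theorem IsCurrentFamily.sum_perm_eq (hx : IsCurrentFamily x) (i j : ι) {m : ℕ} (k : Fin m → ℤ)
    (l : ℤ) :
    ∑ σ : Equiv.Perm (Fin m), ∑ p ∈ Finset.range (m + 1), ((-1) ^ p * (m.choose p) : ℂ) •
      (((List.ofFn fun s => x i (k (σ s))).take p).prod * x j l *
        ((List.ofFn fun s => x i (k (σ s))).drop p).prod) =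
      ((m.factorial : ℂ) * (-1) ^ m) •
        (LieAlgebra.ad ℂ E (x i 0) ^ m) (x j (∑ s, k s + l)) := by
  have hcomm : ∀ u ∈ Set.range (x i), ∀ v ∈ Set.range (x i), u * v = v * u := by
    rintro _ ⟨k, rfl⟩ _ ⟨l, rfl⟩
    have := hx.lie_self i k l
    rwa [LieRing.of_associative_ring_bracket, sub_eq_zero] at this
  -- The `x i k` commute, so they generate a commutative submonoid in which products over finite
  -- sets make sense.
  let _ : CommMonoid (Submonoid.closure (Set.range (x i))) :=
    { (inferInstance : Monoid (Submonoid.closure (Set.range (x i)))) with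
      mul_comm := (Submonoid.isMulCommutative_closure E hcomm).is_comm.comm }
  let ρ : Submonoid.closure (Set.range (x i)) →* E := (Submonoid.closure (Set.range (x i))).subtype
  let a : Fin m → Submonoid.closure (Set.range (x i)) :=
    fun s => ⟨x i (k s), Submonoid.subset_closure ⟨k s, rfl⟩⟩
  have h := sum_perm_sum_range_choose ρ (x j l) a
  have h2 := hx.sum_powerset_eq ρ i j (a := a) (k := k) (fun s => rfl) Finset.univ 0 l
  simp only [pow_zero, Module.End.one_apply, ← Finset.compl_eq_univ_sdiff, zero_add,
    Finset.card_univ, Fintype.card_fin] at h2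
  rw [h2, smul_smul] at h
  rw [← h]
  simp only [map_list_prod, List.map_take, List.map_drop, List.map_ofFn]
  rfl

end Family

namespace QuantumCurrent

/-! ### Relations modulo `ħ` -/

theorem constantCoeff_qPow (m : ℤ) : PowerSeries.constantCoeff (qPow m) = 1 := by
  rw [qPow, ← PowerSeries.coeff_zero_eq_constantCoeff_apply, PowerSeries.coeff_rescale]
  simp

theorem constantCoeff_qBinom (d : ℕ) {m p : ℕ} (hp : p ≤ m) :
    PowerSeries.constantCoeff (qBinom d m p) = m.choose p := by
  rw [qBinom, map_mul, map_mul, PowerSeries.constantCoeff_inv, PowerSeries.constantCoeff_inv,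
    constantCoeff_qFact, constantCoeff_qFact, constantCoeff_qFact, Nat.cast_choose ℂ hp,
    div_eq_mul_inv, mul_inv, mul_assoc]

variable {n : ℕ} (A : Matrix (Fin n) (Fin n) ℤ) (d : Fin n → ℕ)

section Evaluation

variable {E : Type} [Ring E] [Algebra ℂ E] [Algebra ℂ⟦X⟧ E]

/-- The relations of `F̃₊`, for a family of elements of an associative algebra. -/
def IsLoopFamily (x : Fin n → ℤ → E) : Prop :=
  IsCurrentFamily x ∧ ∀ i j, i ≠ j → ∀ l, (LieAlgebra.ad ℂ E (x i 0) ^ serreLen A i j) (x j l) = 0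

variable (hE : ∀ (c : ℂ⟦X⟧) (x : E), c • x = PowerSeries.constantCoeff c • x)
  (f : Free n →ₐ[ℂ⟦X⟧] E) (x : Fin n → ℤ → E) (hf : ∀ i k, f (freeGen i k) = x i k)

include hE hf

theorem map_vertexElt (i j : Fin n) (k l : ℤ) :
    f (vertexElt A d i j k l) = ⁅x i (k + 1), x j l⁆ - ⁅x i k, x j (l + 1)⁆ := by
  simp only [vertexElt, map_sub, map_smul, map_mul, hE, constantCoeff_qPow, one_smul, hf,
    LieRing.of_associative_ring_bracket]
  abel

theorem map_serreElt₀ (i j : Fin n) (l : ℤ) :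
    f (serreElt₀ A d i j l) = (-1 : ℂ) ^ serreLen A i j •
      (LieAlgebra.ad ℂ E (x i 0) ^ serreLen A i j) (x j l) := by
  rw [← sum_range_choose_eq_ad_pow, serreElt₀, map_sum]
  refine Finset.sum_congr rfl fun p hp => ?_
  rw [map_smul, hE, map_mul, map_mul, map_mul, map_pow, map_pow, map_pow, hf, hf,
    constantCoeff_qBinom _ (Nat.lt_succ_iff.1 (Finset.mem_range.1 hp)), map_neg, map_one]

theorem map_serreElt (hx : IsCurrentFamily x) (i j : Fin n) (k : Fin (serreLen A i j) → ℤ)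
    (l : ℤ) :
    f (serreElt A d i j k l) = (((serreLen A i j).factorial : ℂ) * (-1) ^ serreLen A i j) •
      (LieAlgebra.ad ℂ E (x i 0) ^ serreLen A i j) (x j (∑ s, k s + l)) := by
  rw [← hx.sum_perm_eq, serreElt, map_sum]
  refine Finset.sum_congr rfl fun σ _ => ?_
  rw [map_sum]
  refine Finset.sum_congr rfl fun p hp => ?_
  rw [map_smul, hE, map_mul, map_mul, map_mul, map_list_prod, map_list_prod, List.map_take,
    List.map_drop, List.map_ofFn, hf,
    constantCoeff_qBinom _ (Nat.lt_succ_iff.1 (Finset.mem_range.1 hp)), map_pow, map_neg, map_one]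
  simp only [Function.comp_def, hf]

theorem map_ARel_iff : (∀ u v, ARel A d u v → f u = f v) ↔ IsLoopFamily A x := by
  constructor
  · intro h
    have hx : IsCurrentFamily x := fun i j k l => by
      have := h _ _ (.vertex i j k l)
      rwa [map_vertexElt A d hE f x hf, map_zero, sub_eq_zero] at this
    refine ⟨hx, fun i j hij l => ?_⟩
    -- All modes `k` zero already give every `l`; the factor `± m!` is invertible.
    have := h _ _ (.serre i j hij 0 l)
    rw [map_serreElt A d hE f x hf hx, map_zero] at this
    simpa [Nat.factorial_ne_zero] using this
  · rintro ⟨hx, hs⟩ _ _ (⟨i, j, k, l⟩ | ⟨i, j, hij, k, l⟩)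
    · rw [map_vertexElt A d hE f x hf, map_zero, hx, sub_self]
    · rw [map_serreElt A d hE f x hf hx, hs i j hij, smul_zero, map_zero]

theorem map_AtRel_iff : (∀ u v, AtRel A d u v → f u = f v) ↔ IsLoopFamily A x := by
  constructor
  · intro h
    have hx : IsCurrentFamily x := fun i j k l => by
      have := h _ _ (.vertex i j k l)
      rwa [map_vertexElt A d hE f x hf, map_zero, sub_eq_zero] at this
    refine ⟨hx, fun i j hij l => ?_⟩
    have := h _ _ (.serre i j hij l)
    rw [map_serreElt₀ A d hE f x hf, map_zero] at this
    simpa using this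
  · rintro ⟨hx, hs⟩ _ _ (⟨i, j, k, l⟩ | ⟨i, j, hij, l⟩)
    · rw [map_vertexElt A d hE f x hf, map_zero, hx, sub_self]
    · rw [map_serreElt₀ A d hE f x hf, hs i j hij, smul_zero, map_zero]

end Evaluation

/-! ### Classical limits -/

/-- A power series differs from its constant term by a multiple of ħ, which acts by zero. -/
theorem ModHbar.smul_eq {B : Type} [Ring B] [Algebra ℂ⟦X⟧ B] [Algebra ℂ B] [IsScalarTower ℂ ℂ⟦X⟧ B]
    (c : ℂ⟦X⟧) (x : ModHbar B) : c • x = PowerSeries.constantCoeff c • x := by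
  obtain ⟨y, rfl⟩ := RingQuot.mkAlgHom_surjective ℂ⟦X⟧ (HbarRel B) x
  obtain ⟨c', hc'⟩ := PowerSeries.X_dvd_iff.2
    (show PowerSeries.constantCoeff (c - PowerSeries.C (PowerSeries.constantCoeff c)) = 0 by simp)
  have h1 : c = hbar * c' + PowerSeries.constantCoeff c • (1 : ℂ⟦X⟧) := by
    rw [hbar, ← hc', PowerSeries.smul_eq_C_mul, mul_one, sub_add_cancel]
  have h2 : (hbar * c') • RingQuot.mkAlgHom ℂ⟦X⟧ (HbarRel B) y = 0 := by
    rw [mul_smul, ← map_smul, ← map_smul, RingQuot.mkAlgHom_rel ℂ⟦X⟧ (HbarRel.mk (c' • y)), map_zero]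
  conv_lhs => rw [h1]
  rw [add_smul, h2, zero_add, smul_assoc, one_smul]

section Limit

variable (R : Free n → Free n → Prop)

/-- The quotient of the free algebra modulo `ħ`. -/
def toLimit : Free n →ₐ[ℂ⟦X⟧] ModHbar (Sep (RingQuot R)) :=
  modHbar.comp ((RingQuot.mkAlgHom ℂ⟦X⟧ (SepRel (RingQuot R))).comp (RingQuot.mkAlgHom ℂ⟦X⟧ R))

theorem toLimit_surjective : Function.Surjective (toLimit R) :=
  (RingQuot.mkAlgHom_surjective _ _).comp
    ((RingQuot.mkAlgHom_surjective _ _).comp (RingQuot.mkAlgHom_surjective _ _))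

variable {R}

theorem limit_hom_ext {E : Type} [Ring E] [Algebra ℂ E]
    {f g : ModHbar (Sep (RingQuot R)) →ₐ[ℂ] E}
    (h : ∀ i k, f (toLimit R (freeGen i k)) = g (toLimit R (freeGen i k))) : f = g := by
  refine AlgHom.ext fun x => ?_
  obtain ⟨u, rfl⟩ := toLimit_surjective R x
  induction u using FreeAlgebra.induction with
  | grade0 c =>
    rw [Algebra.algebraMap_eq_smul_one, map_smul, ModHbar.smul_eq, map_smul, map_smul, map_one,
      map_one, map_one]
  | grade1 p => exact h p.1 p.2
  | mul u v hu hv => rw [map_mul, map_mul, map_mul, hu, hv]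
  | add u v hu hv => rw [map_add, map_add, map_add, hu, hv]

theorem exists_limit_hom {E : Type} [Ring E] [Algebra ℂ E] [Algebra ℂ⟦X⟧ E]
    [IsScalarTower ℂ ℂ⟦X⟧ E]
    (hE : ∀ (c : ℂ⟦X⟧) (x : E), c • x = PowerSeries.constantCoeff c • x)
    (f : Free n →ₐ[ℂ⟦X⟧] E) (hf : ∀ u v, R u v → f u = f v) :
    ∃ g : ModHbar (Sep (RingQuot R)) →ₐ[ℂ] E, ∀ u, g (toLimit R u) = f u := by
  have hbar_smul : ∀ x : E, hbar • x = 0 := fun x => by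
    rw [hE, hbar, PowerSeries.constantCoeff_X, zero_smul]
  let f₁ := RingQuot.liftAlgHom ℂ⟦X⟧ (s := R) ⟨f, fun u v h => hf u v h⟩
  let f₂ := RingQuot.liftAlgHom ℂ⟦X⟧ (s := SepRel (RingQuot R)) ⟨f₁, by
    rintro _ _ ⟨hx⟩
    -- Divisibility by the first power of ħ is enough, because ħ acts by zero on `E`.
    obtain ⟨y, hy⟩ := hx 1 one_pos
    rw [hy, pow_one, map_smul, hbar_smul, map_zero]⟩
  let f₃ := RingQuot.liftAlgHom ℂ⟦X⟧ (s := HbarRel (Sep (RingQuot R))) ⟨f₂, by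
    rintro _ _ ⟨y⟩
    rw [map_smul, hbar_smul, map_zero]⟩
  refine ⟨f₃.restrictScalars ℂ, fun u => ?_⟩
  change f₃ _ = _
  rw [toLimit, AlgHom.comp_apply, AlgHom.comp_apply, modHbar, RingQuot.liftAlgHom_mkAlgHom_apply,
    RingQuot.liftAlgHom_mkAlgHom_apply, RingQuot.liftAlgHom_mkAlgHom_apply]

/-- If the relations `R` reduce to those of `F̃₊` modulo `ħ`, then the classical limit of the algebra
defined by `R` is `U(F̃₊)`. -/
theorem exists_limit_equiv
    (hR : ∀ (E : Type) [Ring E] [Algebra ℂ E] [Algebra ℂ⟦X⟧ E],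
      (∀ (c : ℂ⟦X⟧) (x : E), c • x = PowerSeries.constantCoeff c • x) →
      ∀ (f : Free n →ₐ[ℂ⟦X⟧] E) (x : Fin n → ℤ → E), (∀ i k, f (freeGen i k) = x i k) →
        ((∀ u v, R u v → f u = f v) ↔ IsLoopFamily A x)) :
    ∃ φ : ModHbar (Sep (RingQuot R)) ≃ₐ[ℂ] UniversalEnvelopingAlgebra ℂ (FPlus A),
      ∀ i k, φ (toLimit R (freeGen i k)) = UniversalEnvelopingAlgebra.ι ℂ (FPlus.gen A i k) := by
  -- For the limit itself, `hR` says that the classes of the `e_i[k]` satisfy the relations of F̃₊;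
  -- this yields the inverse map `ψ`.
  obtain ⟨hx, hs⟩ := (hR _ ModHbar.smul_eq (toLimit R) _ fun _ _ => rfl).1 fun u v h => by
    rw [toLimit, AlgHom.comp_apply, AlgHom.comp_apply, RingQuot.mkAlgHom_rel _ h]
    rfl
  let ψ := UniversalEnvelopingAlgebra.lift ℂ (FPlus.lift A _ hx hs)
  have hψ : ∀ i k, ψ (UniversalEnvelopingAlgebra.ι ℂ (FPlus.gen A i k)) =
      toLimit R (freeGen i k) := fun i k => by
    rw [UniversalEnvelopingAlgebra.lift_ι_apply, FPlus.lift_gen]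
  let E := UniversalEnvelopingAlgebra ℂ (FPlus A)
  let _ : Algebra ℂ⟦X⟧ E := Algebra.compHom E (PowerSeries.constantCoeff (R := ℂ))
  have hE : ∀ (c : ℂ⟦X⟧) (x : E), c • x = PowerSeries.constantCoeff c • x := fun _ _ => rfl
  have : IsScalarTower ℂ ℂ⟦X⟧ E := ⟨fun a c x => by
    rw [hE, hE, PowerSeries.smul_eq_C_mul, map_mul, PowerSeries.constantCoeff_C, mul_smul]⟩
  let x : Fin n → ℤ → E := fun i k => UniversalEnvelopingAlgebra.ι ℂ (FPlus.gen A i k)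
  let f : Free n →ₐ[ℂ⟦X⟧] E := FreeAlgebra.lift ℂ⟦X⟧ fun p => x p.1 p.2
  have hf : ∀ i k, f (freeGen i k) = x i k := fun i k => FreeAlgebra.lift_ι_apply _ _
  -- For U(F̃₊), on which ħ acts by zero, `hR` is used in the other direction: the relations of F̃₊
  -- imply the images of `R`.
  obtain ⟨φ, hφ⟩ := exists_limit_hom hE f ((hR E hE f x hf).2 ⟨fun i j k l => by
      simp only [x]
      rw [← LieHom.map_lie, ← LieHom.map_lie, FPlus.isCurrentFamily_gen],
    fun i j hij l => by
      simp only [x]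
      rw [← LieHom.map_ad_pow, FPlus.ad_pow_gen hij, map_zero]⟩)
  refine ⟨AlgEquiv.ofAlgHom φ ψ ?_ ?_, fun i k => (hφ _).trans (hf i k)⟩
  · apply UniversalEnvelopingAlgebra.hom_ext
    refine FPlus.hom_ext fun i k => ?_
    exact (congrArg φ (hψ i k)).trans ((hφ _).trans (hf i k))
  · refine limit_hom_ext fun i k => ?_
    change ψ (φ _) = _
    rw [hφ, hf, hψ]
    rfl

end Limit

end QuantumCurrent

end

theorem proposition1p5 {n : ℕ} (A : Matrix (Fin n) (Fin n) ℤ) (d : Fin n → ℕ)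
    (hA : IsGenCartan A) (hd : IsSymmetrizer A d)
    (S : Finset (Fin n)) (hS : IsCorankSet A S) :
    -- `F̃₊` is a Lie algebra graded by the set of positive roots
    (SetLike.GradedBracket (FPlus.part A) ∧
      (∀ α : Fin n → ℤ, α ∉ KacMoody.posRoots A S → FPlus.part A α = ⊥) ∧
      DirectSum.IsInternal (fun α : KacMoody.posRoots A S => FPlus.part A α.1)) ∧
    -- the classical limits of both quantum current algebras are `U(F̃₊)`
    (∃ φ : QuantumCurrent.ModHbar (QuantumCurrent.U A d) ≃ₐ[ℂ]
        UniversalEnvelopingAlgebra ℂ (FPlus A),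
      ∀ i k, φ (QuantumCurrent.modHbar (QuantumCurrent.uGen A d i k)) =
        UniversalEnvelopingAlgebra.ι ℂ (FPlus.gen A i k)) ∧
    (∃ φ : QuantumCurrent.ModHbar (QuantumCurrent.Ut A d) ≃ₐ[ℂ]
        UniversalEnvelopingAlgebra ℂ (FPlus A),
      ∀ i k, φ (QuantumCurrent.modHbar (QuantumCurrent.utGen A d i k)) =
        UniversalEnvelopingAlgebra.ι ℂ (FPlus.gen A i k)) ∧
    -- the morphism `j₊`
    ∃ j : FPlus A →ₗ⁅ℂ⁆ KacMoody.LnPlus A S,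
      (∀ i k, j (FPlus.gen A i k) = KacMoody.loopMonomial A S (KacMoody.nGen A S i) k) ∧
      (∀ j' : FPlus A →ₗ⁅ℂ⁆ KacMoody.LnPlus A S,
        (∀ i k, j' (FPlus.gen A i k) = KacMoody.loopMonomial A S (KacMoody.nGen A S i) k) →
          j' = j) ∧
      (∀ α : Fin n → ℤ, ∀ x ∈ FPlus.part A α, j x ∈ KacMoody.LnPart A S α) ∧
      Function.Surjective j ∧
      (j.ker.toSubmodule ≤ ⨆ α ∈ KacMoody.imPosRoots A S, FPlus.part A α) := by
  refine ⟨⟨inferInstance, fun α hα => ?_, FPlus.isInternal_part hA S⟩,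
    QuantumCurrent.exists_limit_equiv A fun E _ _ _ hE f x hf =>
      QuantumCurrent.map_ARel_iff A d hE f x hf,
    QuantumCurrent.exists_limit_equiv A fun E _ _ _ hE f x hf =>
      QuantumCurrent.map_AtRel_iff A d hE f x hf,
    FPlus.toLnPlus A S, FPlus.toLnPlus_gen, fun j' hj' => ?_,
    fun α x hx => FPlus.toLnPlus_mem_LnPart hx, FPlus.toLnPlus_surjective,
    FPlus.ker_toLnPlus_le hA hS⟩
  · by_contra h
    exact hα (FPlus.mem_posRoots hA h)
  · exact FPlus.hom_ext fun i k => (hj' i k).trans (FPlus.toLnPlus_gen i k).symm
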